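/- **Monomials and moments.** Let $N\ge 1$, let $A_1,\dots,A_p$ be complex $N\times N$ matrices and let $\mathcal A=\mathbb C\langle u,u^{-1},a_i,a_i^*;1\le i\le p\rangle$ be the algebra of noncommutative polynomials in these (formally unrelated) letters. Let $P_1,\dots,P_l$ ($l\ge 1$) be monomials $$P_i=M_{i,1}u^{\epsilon_{i,1}}M_{i,2}u^{\epsilon_{i,2}}\cdots M_{i,d_i}u^{\epsilon_{i,d_i}},\qquad d_i\ge 1,\ \epsilon_{i,j}\in\{\pm1\},$$ where each $M_{i,j}$ is a (possibly empty) word in the letters $a_1,a_1^*,\dots,a_p,a_p^*$. Let $$\alpha^N_{0,l}(P_1,\dots,P_l)=\int_{\mathbb U(N)}\prod_{i=1}^l\operatorname{Tr}\big(P_i(U,U^*,A_1,A_1^*,\dots,A_p,A_p^*)\big)\,dU,$$ where $dU$ is the Haar probability measure. Put $\deg \mathbf P=d_1+\cdots+d_l$ and $m=\frac12\deg \mathbf P$. Number the factors consecutively, so that the pair $(i,j)$ gets the number $d_1+\cdots+d_{i-1}+j\in[2m]=\{1,\dots,\deg\mathbf P\}$, and let $\mathbf M_{\mathbf P}=(M_k)_{k\in[2m]}$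 (words evaluated at the $A_i,A_i^*$) and $\epsilon_{\mathbf P}=(\epsilon(k))_{k\in[2m]}$ be the families of words and signs. Let $\gamma_{\mathbf P}$ be the permutation of $[2m]$ having one cycle $(d_1+\cdots+d_{i-1}+1,\dots,d_1+\cdots+d_i)$ for each $i$. For a permutation $\sigma$ of $[2m]$ put $\operatorname{Tr}_\sigma(\mathbf M)=\prod_{c}\operatorname{Tr}(M_{i_1}M_{i_2}\cdots M_{i_k})$, the product being over all cycles $c=(i_1,\dots,i_k)$ of $\sigma$, fixed points included. **Maps.** An oriented map (not necessarily connected) is a graph with oriented edges embedded in a compact oriented surface with simply connected faces, up to orientation-preserving homeomorphism, given as a rotation system: a finite set of half-edges, a permutation $\sigma$ sending each half-edge to the next one counterclockwise around its vertex (the vertices are the cycles of $\sigma$), a fixed-point-free involution $\alpha$ exchanging the two half-edges of each edge, one of which is outgoing and the other ingoing; isomorphic systems are identified. The permutation $\varphi=\sigma^{-1}\alpha$ sends a half-edge to the next half-edge, counterclockwise around the face at its left, that has this face at its left. A map of unitary type with a finite totally ordered label set $I$ and $r$ black vertices is an oriented map with vertices colored black or white such that: 1. there are $r$ black vertices, numbered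 from $1$ to $r$; each has degree $4$, and ingoing and outgoing half-edges alternate around it; 2. the half-edges connected to white vertices (the white half-edges) are labelled bijectively by $I$; 3. if an edge is oriented from the black vertex number $k$ to the black vertex number $l$, then $k<l$. Isomorphisms preserve orientation, colors, numbers and labels. For such a map $\mathcal C$: * $\epsilon_{\mathcal C}(i)=+1$ if the white half-edge labelled $i$ is outgoing, and $-1$ if it is ingoing; * $\rho_{\mathcal C}(i)$ is the label of the half-edge following the white half-edge labelled $i$ counterclockwise around its vertex; * $\phi_{\mathcal C}(i)$ is the label of the first white half-edge among $\varphi(h),\varphi^2(h),\dots$, where $h$ is the white half-edge labelled $i$. A half-edge $h$ connected to a black vertex gets the label of the first white half-edge among $\varphi^{-1}(h),\varphi^{-2}(h),\dots$ (there always is one). The value of a black vertex is the largest of the labels of its outgoing half-edges, and $\mathcal C$ is nondecreasing if the values of the black vertices $1,\dots,r$ form a nondecreasing sequence. Let $\mathfrak C^r_{I,\epsilon,\rho}$ be the set of nondecreasing maps of unitary type with label set $I$, $r$ black vertices, $\epsilon_{\mathcal C}=\epsilon$ and $\rho_{\mathcal C}=\rho$. **Statement.** If $m\le N$, then the sets $\mathfrak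 C^r_{[2m],\epsilon_{\mathbf P},\gamma_{\mathbf P}^{-1}}$, $r\ge0$, are finite and $$\alpha^N_{0,l}(P_1,\dots,P_l)=\sum_{r\ge0}\frac{(-1)^r}{N^{r+m}}\sum_{\mathcal C\in\mathfrak C^r_{[2m],\epsilon_{\mathbf P},\gamma_{\mathbf P}^{-1}}}\operatorname{Tr}_{\phi_{\mathcal C}}(\mathbf M_{\mathbf P}),$$ and the series over $r$ converges absolutely. -/

import Mathlib

noncomputable section

namespace UnitaryMaps

open MeasureTheory

/-! ## Monomials in `u`, `u⁻¹`, `a_i`, `a_i^*` and their Haar moments -/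

/-- The letters `a_i`, `a_i^*`, for `i` in a set of `p` indices. -/
inductive CoeffLetter (p : ℕ) : Type
  | a (i : Fin p) : CoeffLetter p
  | aStar (i : Fin p) : CoeffLetter p

/-- The letters `u`, `u⁻¹` and `a_i`, `a_i^*`. -/
inductive Letter (p : ℕ) : Type
  | u : Letter p
  | uInv : Letter p
  | coeff (x : CoeffLetter p) : Letter p

/-- The algebra of noncommutative polynomials `ℂ⟨u, u⁻¹, a_i, a_i^*⟩`; there is no relation between
the formal variables. -/
abbrev NCPoly (p : ℕ) : Type := FreeAlgebra ℂ (Letter p)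

/-- A monomial `M₁ u^{ε₁} M₂ u^{ε₂} ⋯ M_d u^{ε_d}` with `d ≥ 1`, signs `ε_j = ±1` and (possibly
empty) words `M_j` in the letters `a_i`, `a_i^*`. -/
structure Monomial (p : ℕ) : Type where
  /-- the degree `d`, the total number of letters `u` and `u⁻¹` -/
  deg : ℕ
  deg_pos : 1 ≤ deg
  /-- the words `M_j` -/
  word : Fin deg → List (CoeffLetter p)
  /-- the signs `ε_j` -/
  sign : Fin deg → ℤˣ

/-- The monomial as an element of the algebra of noncommutative polynomials. -/
def Monomial.toPoly {p : ℕ} (P : Monomial p) : NCPoly p :=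
  (List.ofFn fun j : Fin P.deg =>
    ((P.word j).map fun x => FreeAlgebra.ι ℂ (Letter.coeff x)).prod *
      FreeAlgebra.ι ℂ (if P.sign j = 1 then Letter.u else Letter.uInv)).prod

section Moments

variable {N p : ℕ}

/-- The matrix substituted for a letter `a_i` or `a_i^*`. -/
def CoeffLetter.toMatrix (A : Fin p → Matrix (Fin N) (Fin N) ℂ) :
    CoeffLetter p → Matrix (Fin N) (Fin N) ℂ
  | CoeffLetter.a i => A i
  | CoeffLetter.aStar i => (A i).conjTranspose

/-- The matrix substituted for a letter; `u ↦ U` and `u⁻¹ ↦ U^*`. -/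
def Letter.toMatrix (A : Fin p → Matrix (Fin N) (Fin N) ℂ) (U : Matrix (Fin N) (Fin N) ℂ) :
    Letter p → Matrix (Fin N) (Fin N) ℂ
  | Letter.u => U
  | Letter.uInv => U.conjTranspose
  | Letter.coeff x => x.toMatrix A

/-- Evaluation of noncommutative polynomials at `U, U^*, A_1, A_1^*, …, A_p, A_p^*`. -/
def evalPoly (A : Fin p → Matrix (Fin N) (Fin N) ℂ) (U : Matrix (Fin N) (Fin N) ℂ) :
    NCPoly p →ₐ[ℂ] Matrix (Fin N) (Fin N) ℂ :=
  FreeAlgebra.lift ℂ (Letter.toMatrix A U)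

instance unitaryGroupMeasurableSpace (N : ℕ) :
    MeasurableSpace (Matrix.unitaryGroup (Fin N) ℂ) := borel _

instance unitaryGroupBorelSpace (N : ℕ) : BorelSpace (Matrix.unitaryGroup (Fin N) ℂ) := ⟨rfl⟩

instance unitaryGroupCompactSpace (N : ℕ) : CompactSpace (Matrix.unitaryGroup (Fin N) ℂ) := by
  refine isCompact_iff_compactSpace.mp ?_
  have hK : IsCompact (Set.univ.pi fun _ : Fin N => Set.univ.pi fun _ : Fin N =>
      Metric.closedBall (0 : ℂ) 1) :=
    isCompact_univ_pi fun _ => isCompact_univ_pi fun _ => isCompact_closedBall 0 1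
  refine IsCompact.of_isClosed_subset (X := Matrix (Fin N) (Fin N) ℂ) hK ?_ ?_
  · have hset : ((Matrix.unitaryGroup (Fin N) ℂ : Submonoid (Matrix (Fin N) (Fin N) ℂ)) :
        Set (Matrix (Fin N) (Fin N) ℂ)) = {U | star U * U = 1} := by
      ext U
      exact Matrix.mem_unitaryGroup_iff'
    rw [hset]
    exact isClosed_eq (by fun_prop) continuous_const
  · intro U hU i _ j _
    simpa using entry_norm_bound_of_unitary hU i j

/-- The Haar measure on the unitary group `𝕌(N)`, with total mass one. -/
def haarUnitary (N : ℕ) : Measure (Matrix.unitaryGroup (Fin N) ℂ) :=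
  Measure.haarMeasure ⊤

/-- The joint moment `α^N_{0,l}(Q₁, …, Q_l) = ∫ Tr(Q₁) ⋯ Tr(Q_l) dU` under the Haar measure. -/
def haarMoment (A : Fin p → Matrix (Fin N) (Fin N) ℂ) {l : ℕ} (Q : Fin l → NCPoly p) : ℂ :=
  ∫ U : Matrix.unitaryGroup (Fin N) ℂ,
    ∏ i, (evalPoly A (U : Matrix (Fin N) (Fin N) ℂ) (Q i)).trace ∂(haarUnitary N)

end Moments

/-! ## The data attached to a tuple of monomials

The factors of `P₁, …, P_l` are numbered consecutively (starting at `0`): the `j`-th factor of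
`P_i` has the number `d₁ + ⋯ + d_{i-1} + j`. This is the bijection `finSigmaFinEquiv`. -/

section Tuples

variable {p l : ℕ}

/-- The total degree `d₁ + ⋯ + d_l`. -/
abbrev totalDeg (P : Fin l → Monomial p) : ℕ := ∑ i, (P i).deg

/-- The signs `(ε_{1,1}, …, ε_{1,d₁}, …, ε_{l,1}, …, ε_{l,d_l})`. -/
def signs (P : Fin l → Monomial p) (k : Fin (totalDeg P)) : ℤˣ :=
  (P (finSigmaFinEquiv.symm k).1).sign (finSigmaFinEquiv.symm k).2

/-- The matrices `(M_{1,1}, …, M_{1,d₁}, …, M_{l,1}, …, M_{l,d_l})`. -/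
def coeffs {N : ℕ} (A : Fin p → Matrix (Fin N) (Fin N) ℂ) (P : Fin l → Monomial p)
    (k : Fin (totalDeg P)) : Matrix (Fin N) (Fin N) ℂ :=
  (((P (finSigmaFinEquiv.symm k).1).word (finSigmaFinEquiv.symm k).2).map
    (CoeffLetter.toMatrix A)).prod

/-- The permutation `(1, …, d₁)(d₁ + 1, …, d₁ + d₂) ⋯` with one cycle for each monomial. -/
def gammaPerm (P : Fin l → Monomial p) : Equiv.Perm (Fin (totalDeg P)) :=
  finSigmaFinEquiv.permCongr (Equiv.Perm.sigmaCongrRight fun i => finRotate (P i).deg)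

end Tuples

/-! ## Traces along a permutation -/

section Traces

variable {N : ℕ} {I : Type} [Fintype I]

/-- `Tr(M_{i} M_{σ(i)} M_{σ²(i)} ⋯)`, the product running once along the cycle of `i`. -/
def cycleTrace (σ : Equiv.Perm I) (M : I → Matrix (Fin N) (Fin N) ℂ) (i : I) : ℂ :=
  (List.ofFn fun k : Fin (Function.minimalPeriod σ i) => M ((σ ^ (k : ℕ)) i)).prod.trace

theorem cycleTrace_apply (σ : Equiv.Perm I) (M : I → Matrix (Fin N) (Fin N) ℂ) (i : I) :
    cycleTrace σ M (σ i) = cycleTrace σ M i := by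
  have hper : i ∈ Function.periodicPts σ :=
    (Function.Injective.mem_periodicPts σ.injective i)
  have hmp : Function.minimalPeriod σ (σ i) = Function.minimalPeriod σ i :=
    Function.minimalPeriod_apply hper
  have hlast : (σ ^ Function.minimalPeriod σ i) i = i := by
    rw [Equiv.Perm.coe_pow]
    exact Function.isPeriodicPt_minimalPeriod σ i
  have hpos := Function.minimalPeriod_pos_of_mem_periodicPts hper
  unfold cycleTrace
  rw [hmp]
  generalize Function.minimalPeriod σ i = d at hpos hlast
  obtain ⟨c, rfl⟩ : ∃ c, d = c + 1 := ⟨d - 1, by omega⟩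
  have h1 : (List.ofFn fun k : Fin (c + 1) => M ((σ ^ (k : ℕ)) (σ i))).prod =
      (List.ofFn fun k : Fin c => M ((σ ^ ((k : ℕ) + 1)) i)).prod * M i := by
    rw [List.ofFn_succ', List.concat_eq_append, List.prod_append]
    simp only [Fin.val_castSucc, Fin.val_last, List.prod_singleton, pow_succ,
      Equiv.Perm.mul_apply] at hlast ⊢
    rw [hlast]
  have h2 : (List.ofFn fun k : Fin (c + 1) => M ((σ ^ (k : ℕ)) i)).prod =
      M i * (List.ofFn fun k : Fin c => M ((σ ^ ((k : ℕ) + 1)) i)).prod := by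
    rw [List.ofFn_succ, List.prod_cons]
    simp
  rw [h1, h2, Matrix.trace_mul_comm]

theorem cycleTrace_congr (σ : Equiv.Perm I) (M : I → Matrix (Fin N) (Fin N) ℂ) (i j : I)
    (h : σ.SameCycle i j) : cycleTrace σ M i = cycleTrace σ M j := by
  obtain ⟨n, -, rfl⟩ := h.exists_pow_eq'
  induction n with
  | zero => simp
  | succ n ih =>
    rw [pow_succ', Equiv.Perm.mul_apply, cycleTrace_apply]
    exact ih ⟨n, by simp⟩

open Classical in
/-- `Tr_σ(M)`, the product over all the cycles of `σ` (fixed points included) of the trace of the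
product of the matrices along the cycle. -/
def permTrace (σ : Equiv.Perm I) (M : I → Matrix (Fin N) (Fin N) ℂ) : ℂ :=
  ∏ c : Quotient (Equiv.Perm.SameCycle.setoid σ),
    Quotient.lift (cycleTrace σ M) (fun i j h => cycleTrace_congr σ M i j h) c

end Traces

/-! ## First return permutations -/

section FirstReturn

variable {H : Type} [Finite H]

theorem exists_return (f : Equiv.Perm H) (p : H → Prop) (x : {h // p h}) :
    ∃ k : ℕ, 0 < k ∧ p ((f ^ k) x) :=
  ⟨orderOf f, orderOf_pos f, by rw [pow_orderOf_eq_one]; exact x.2⟩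

open Classical in
/-- The first element satisfying `p` among `f x, f² x, f³ x, …`. -/
def firstReturnFun (f : Equiv.Perm H) (p : H → Prop) (x : {h // p h}) : {h // p h} :=
  ⟨(f ^ Nat.find (exists_return f p x)) x, (Nat.find_spec (exists_return f p x)).2⟩

theorem firstReturnFun_eq (f : Equiv.Perm H) (p : H → Prop) (x y : {h // p h}) {k : ℕ}
    (hk : 0 < k) (hy : (f ^ k) (x : H) = y) (hmin : ∀ j, 0 < j → j < k → ¬ p ((f ^ j) x)) :
    firstReturnFun f p x = y := by
  classical
  have : Nat.find (exists_return f p x) = k := by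
    rw [Nat.find_eq_iff]
    exact ⟨⟨hk, by rw [hy]; exact y.2⟩, fun j hj hc => hmin j hc.1 hj hc.2⟩
  apply Subtype.ext
  simp only [firstReturnFun]
  rw [← hy]
  congr 2

theorem firstReturnFun_spec (f : Equiv.Perm H) (p : H → Prop) (x : {h // p h}) :
    ∃ k : ℕ, 0 < k ∧ (f ^ k) (x : H) = firstReturnFun f p x ∧
      ∀ j, 0 < j → j < k → ¬ p ((f ^ j) x) := by
  classical
  refine ⟨Nat.find (exists_return f p x), (Nat.find_spec (exists_return f p x)).1, ?_, ?_⟩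
  · simp only [firstReturnFun]
  · intro j hj hlt hp
    exact Nat.find_min (exists_return f p x) hlt ⟨hj, hp⟩

theorem firstReturnFun_injective (f : Equiv.Perm H) (p : H → Prop) :
    Function.Injective (firstReturnFun f p) := by
  have key : ∀ (x y : {h // p h}) (a b : ℕ), 0 < a → a ≤ b →
      (f ^ a) (x : H) = (f ^ b) (y : H) → (∀ j, 0 < j → j < b → ¬ p ((f ^ j) y)) → x = y := by
    intro x y a b ha hab hxy hmin
    obtain ⟨c, rfl⟩ := Nat.exists_eq_add_of_le hab
    rw [pow_add, Equiv.Perm.mul_apply] at hxy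
    have hx : (x : H) = (f ^ c) y := (f ^ a).injective hxy
    rcases Nat.eq_zero_or_pos c with rfl | hc
    · exact Subtype.ext (by simpa using hx)
    · exact absurd (by rw [← hx]; exact x.2) (hmin c hc (by omega))
  intro x y hxy
  obtain ⟨a, ha, hax, hamin⟩ := firstReturnFun_spec f p x
  obtain ⟨b, hb, hby, hbmin⟩ := firstReturnFun_spec f p y
  rcases le_total a b with h | h
  · exact key x y a b ha h (by rw [hax, hby, hxy]) hbmin
  · exact (key y x b a hb h (by rw [hax, hby, hxy]) hamin).symm

/-- The first return permutation of `f` on the subset defined by `p`. -/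
def firstReturn (f : Equiv.Perm H) (p : H → Prop) : Equiv.Perm {h // p h} :=
  Equiv.ofBijective (firstReturnFun f p)
    (Finite.injective_iff_bijective.mp (firstReturnFun_injective f p))

end FirstReturn

/-! ## Oriented maps -/

/-- An oriented map (not necessarily connected), given as a rotation system: a finite set of
half-edges, the permutation `next` sending a half-edge to the next one in the counterclockwise
direction around its vertex, the fixed point free involution `opp` exchanging the two half-edges of
an edge, and the orientation: `sign h = 1` if `h` is outgoing, `sign h = -1` if `h` is ingoing. -/
structure OrientedMap : Type 1 where
  HalfEdge : Type
  finite : Finite HalfEdge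
  next : Equiv.Perm HalfEdge
  opp : Equiv.Perm HalfEdge
  opp_opp : ∀ h, opp (opp h) = h
  opp_ne : ∀ h, opp h ≠ h
  sign : HalfEdge → ℤˣ
  sign_opp : ∀ h, sign (opp h) = -sign h

namespace OrientedMap

variable (C : OrientedMap)

instance : Finite C.HalfEdge := C.finite

/-- The vertices are the cycles of `next`. -/
def Vertex : Type := Quotient (Equiv.Perm.SameCycle.setoid C.next)

/-- The vertex to which a half-edge is connected. -/
def vertex (h : C.HalfEdge) : C.Vertex :=
  Quotient.mk (Equiv.Perm.SameCycle.setoid C.next) h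

/-- Starting from the half-edge `h` and turning in the counterclockwise direction around the face
at the left of `h`, the next half-edge with this face at its left. (Walk along the edge of `h`
with the face at the left, then turn left, that is, take the next half-edge in the clockwise
direction around the vertex that was reached.) The faces are the cycles of this permutation. -/
def face : Equiv.Perm C.HalfEdge := C.opp.trans C.next.symm

theorem vertex_next (h : C.HalfEdge) : C.vertex (C.next h) = C.vertex h :=
  Quotient.sound (s := Equiv.Perm.SameCycle.setoid C.next)
    (Equiv.Perm.sameCycle_apply_left.mpr (Equiv.Perm.SameCycle.refl _ _))

theorem next_face (h : C.HalfEdge) : C.next (C.face h) = C.opp h := by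
  simp [face]

theorem vertex_face (h : C.HalfEdge) : C.vertex (C.face h) = C.vertex (C.opp h) := by
  rw [← C.next_face, C.vertex_next]

end OrientedMap

/-! ## Maps of unitary type -/

/-- A map of unitary type with labels in `I` and `r` black vertices. The numbers of the black
vertices are the elements of `Fin r`. -/
structure UnitaryMap (I : Type) (r : ℕ) : Type 1 extends OrientedMap where
  /-- the black vertices; the other vertices are white -/
  IsBlack : toOrientedMap.Vertex → Prop
  /-- the numbering of the black vertices -/
  black : Fin r ≃ {v // IsBlack v}
  degree_black : ∀ v, IsBlack v → Nat.card {h // toOrientedMap.vertex h = v} = 4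
  alternated_black : ∀ h, IsBlack (toOrientedMap.vertex h) → sign (next h) = -sign h
  /-- the labelling of the white half-edges, those connected to white vertices -/
  white : I ≃ {h // ¬ IsBlack (toOrientedMap.vertex h)}
  /-- an edge from the black vertex number `k` to the black vertex number `l` has `k < l` -/
  number_lt : ∀ (h : HalfEdge) (k l : Fin r), sign h = 1 →
    toOrientedMap.vertex h = black k → toOrientedMap.vertex (opp h) = black l → k < l

namespace UnitaryMap

variable {I : Type} {r : ℕ} (C : UnitaryMap I r)

/-- The half-edge `h` is white, i.e. connected to a white vertex. -/
def IsWhite (h : C.HalfEdge) : Prop := ¬ C.IsBlack (C.vertex h)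

theorem isWhite_next (h : C.HalfEdge) : C.IsWhite (C.next h) ↔ C.IsWhite h := by
  rw [IsWhite, IsWhite, C.vertex_next]

/-- `ε_C`: the orientation of the white half-edges. -/
def eps (i : I) : ℤˣ := C.sign (C.white i)

/-- `ρ_C`: the next half-edge counterclockwise around a white vertex, in terms of labels. -/
def rho : Equiv.Perm I :=
  (C.white.trans (C.next.subtypePerm C.isWhite_next)).trans C.white.symm

/-- `φ_C`: the next white half-edge around the face at the left of a white half-edge, turning
counterclockwise around the face, in terms of labels. -/
def phi : Equiv.Perm I :=
  (C.white.trans (firstReturn C.face C.IsWhite)).trans C.white.symm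

/-- Each face is incident to a white vertex. -/
theorem exists_white_face (h : C.HalfEdge) : ∃ k : ℕ, C.IsWhite ((C.face ^ k) h) := by
  by_contra hcon
  have hb : ∀ k : ℕ, C.IsBlack (C.vertex ((C.face ^ k) h)) := fun k => by
    by_contra hk
    exact hcon ⟨k, hk⟩
  have hsucc : ∀ k : ℕ, (C.face ^ (k + 1)) h = C.face ((C.face ^ k) h) := fun k => by
    rw [pow_succ', Equiv.Perm.mul_apply]
  have hsign : ∀ k : ℕ, C.sign ((C.face ^ k) h) = C.sign h := by
    intro k
    induction k with
    | zero => simp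
    | succ k ih =>
      have := C.alternated_black _ (hb (k + 1))
      rw [hsucc, C.next_face, C.sign_opp, neg_inj, ih] at this
      rw [hsucc, ← this]
  let n : ℕ → Fin r := fun k => C.black.symm ⟨_, hb k⟩
  have hn : ∀ k, C.vertex ((C.face ^ k) h) = C.black (n k) := fun k => by simp [n]
  have hopp : ∀ k, C.vertex (C.opp ((C.face ^ k) h)) = C.black (n (k + 1)) := fun k => by
    rw [← C.vertex_face, ← hsucc, hn]
  have hper : n (orderOf C.face) = n 0 := by
    apply C.black.injective
    apply Subtype.ext
    rw [← hn, ← hn, pow_orderOf_eq_one, pow_zero]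
  have hpos := orderOf_pos C.face
  rcases Int.units_eq_one_or (C.sign h) with hs | hs
  · have hmono : StrictMono n := strictMono_nat_of_lt_succ fun k =>
      C.number_lt _ _ _ ((hsign k).trans hs) (hn k) (hopp k)
    exact (hmono hpos).ne' hper
  · have hanti : StrictAnti n := strictAnti_nat_of_succ_lt fun k =>
      C.number_lt (C.opp ((C.face ^ k) h)) _ _ (by rw [C.sign_opp, hsign, hs, neg_neg])
        (hopp k) (by rw [C.opp_opp]; exact hn k)
    exact (hanti hpos).ne hper

theorem exists_white_face_inv (h : C.HalfEdge) : ∃ k : ℕ, C.IsWhite ((C.face⁻¹ ^ k) h) := by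
  obtain ⟨k, hk⟩ := C.exists_white_face h
  have : (C.face⁻¹).SameCycle h ((C.face ^ k) h) :=
    Equiv.Perm.sameCycle_inv.mpr ⟨k, by simp⟩
  obtain ⟨j, -, hj⟩ := this.exists_pow_eq'
  exact ⟨j, by rw [hj]; exact hk⟩

open Classical in
/-- The label of an arbitrary half-edge `h`: that of the first white half-edge encountered (`h`
included) when turning in the clockwise direction around the face at the left of `h`. -/
def labelOf (h : C.HalfEdge) : I :=
  C.white.symm ⟨(C.face⁻¹ ^ Nat.find (C.exists_white_face_inv h)) h,
    Nat.find_spec (C.exists_white_face_inv h)⟩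

theorem exists_outgoing (k : Fin r) : ∃ h, C.vertex h = C.black k ∧ C.sign h = 1 := by
  obtain ⟨h, hh⟩ := Quotient.exists_rep (C.black k).1
  change C.vertex h = _ at hh
  rcases Int.units_eq_one_or (C.sign h) with hs | hs
  · exact ⟨h, hh, hs⟩
  · refine ⟨C.next h, by rw [C.vertex_next, hh], ?_⟩
    rw [C.alternated_black h (by rw [hh]; exact (C.black k).2), hs, neg_neg]

/-- The value of the black vertex number `k`: the largest of the labels of the outgoing half-edges
connected to it. -/
def val [LinearOrder I] (k : Fin r) : I :=
  ((Set.toFinite {h | C.vertex h = C.black k ∧ C.sign h = 1}).toFinset.image C.labelOf).max' (by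
    obtain ⟨h, hh⟩ := C.exists_outgoing k
    exact ⟨C.labelOf h, Finset.mem_image_of_mem _ (by simpa using hh)⟩)

/-- The map is nondecreasing: `val(b₁) ≤ val(b₂) ≤ ⋯ ≤ val(b_r)`. -/
def IsNondecreasing [LinearOrder I] : Prop := Monotone C.val

/-- An isomorphism of maps of unitary type: a bijection between the half-edges which preserves the
cyclic order around the vertices, the edges, the orientation, the colours, the numbering of the
black vertices and the labels of the white half-edges. -/
structure Iso (C D : UnitaryMap I r) : Type where
  toEquiv : C.HalfEdge ≃ D.HalfEdge
  map_next : ∀ h, toEquiv (C.next h) = D.next (toEquiv h)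
  map_opp : ∀ h, toEquiv (C.opp h) = D.opp (toEquiv h)
  map_sign : ∀ h, D.sign (toEquiv h) = C.sign h
  map_isWhite : ∀ h, D.IsWhite (toEquiv h) ↔ C.IsWhite h
  map_black : ∀ h k, D.vertex (toEquiv h) = D.black k ↔ C.vertex h = C.black k
  map_white : ∀ i, toEquiv (C.white i) = D.white i

/-- The identity isomorphism. -/
def Iso.refl (C : UnitaryMap I r) : Iso C C where
  toEquiv := Equiv.refl _
  map_next _ := rfl
  map_opp _ := rfl
  map_sign _ := rfl
  map_isWhite _ := Iff.rfl
  map_black _ _ := Iff.rfl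
  map_white _ := rfl

/-- The inverse isomorphism. -/
def Iso.symm {C D : UnitaryMap I r} (e : Iso C D) : Iso D C where
  toEquiv := e.toEquiv.symm
  map_next h := by rw [Equiv.symm_apply_eq, e.map_next, Equiv.apply_symm_apply]
  map_opp h := by rw [Equiv.symm_apply_eq, e.map_opp, Equiv.apply_symm_apply]
  map_sign h := by rw [← e.map_sign, Equiv.apply_symm_apply]
  map_isWhite h := by rw [← e.map_isWhite, Equiv.apply_symm_apply]
  map_black h k := by rw [← e.map_black, Equiv.apply_symm_apply]
  map_white i := by rw [Equiv.symm_apply_eq, e.map_white]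

/-- The composition of two isomorphisms. -/
def Iso.trans {C D E : UnitaryMap I r} (e : Iso C D) (f : Iso D E) : Iso C E where
  toEquiv := e.toEquiv.trans f.toEquiv
  map_next h := by simp [e.map_next, f.map_next]
  map_opp h := by simp [e.map_opp, f.map_opp]
  map_sign h := by simp [e.map_sign, f.map_sign]
  map_isWhite h := by simp [e.map_isWhite, f.map_isWhite]
  map_black h k := by simp [e.map_black, f.map_black]
  map_white i := by simp [e.map_white, f.map_white]

theorem Iso.map_face {C D : UnitaryMap I r} (e : Iso C D) (h : C.HalfEdge) :
    e.toEquiv (C.face h) = D.face (e.toEquiv h) := by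
  apply D.next.injective
  rw [D.next_face, ← e.map_next, C.next_face, e.map_opp]

theorem Iso.map_face_pow {C D : UnitaryMap I r} (e : Iso C D) (k : ℕ) (h : C.HalfEdge) :
    e.toEquiv ((C.face ^ k) h) = (D.face ^ k) (e.toEquiv h) := by
  induction k with
  | zero => simp
  | succ k ih => rw [pow_succ', pow_succ', Equiv.Perm.mul_apply, Equiv.Perm.mul_apply,
      e.map_face, ih]

theorem Iso.phi_eq {C D : UnitaryMap I r} (e : Iso C D) : C.phi = D.phi := by
  ext i
  obtain ⟨k, hk, hki, hmin⟩ := firstReturnFun_spec C.face C.IsWhite (C.white i)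
  have hD : firstReturnFun D.face D.IsWhite (D.white i) = D.white (C.phi i) := by
    refine firstReturnFun_eq D.face D.IsWhite _ _ hk ?_ ?_
    · rw [← e.map_white, ← e.map_face_pow, hki, ← e.map_white]
      congr 2
      exact (C.white.apply_symm_apply _).symm
    · intro j hj hlt
      rw [← e.map_white, ← e.map_face_pow, e.map_isWhite]
      exact hmin j hj hlt
  have : D.phi i = D.white.symm (firstReturnFun D.face D.IsWhite (D.white i)) := rfl
  rw [this, hD]
  exact (D.white.symm_apply_apply _).symm

end UnitaryMap

/-- The nondecreasing maps of unitary type `C` with labels in `I`, with `r` black vertices, and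
with `ε_C = ε` and `ρ_C = ρ`, before isomorphic ones are identified. -/
def NondecreasingMap (I : Type) [LinearOrder I] (r : ℕ) (ε : I → ℤˣ) (ρ : Equiv.Perm I) :
    Type 1 :=
  {C : UnitaryMap I r // C.IsNondecreasing ∧ C.eps = ε ∧ C.rho = ρ}

/-- Isomorphism of maps of unitary type. -/
instance NondecreasingMap.setoid (I : Type) [LinearOrder I] (r : ℕ) (ε : I → ℤˣ)
    (ρ : Equiv.Perm I) : Setoid (NondecreasingMap I r ε ρ) where
  r C D := Nonempty (UnitaryMap.Iso C.1 D.1)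
  iseqv :=
    { refl := fun C => ⟨UnitaryMap.Iso.refl C.1⟩
      symm := fun ⟨e⟩ => ⟨e.symm⟩
      trans := fun ⟨e⟩ ⟨f⟩ => ⟨e.trans f⟩ }

/-- The set `ℭ^r_{I, ε, ρ}` of nondecreasing maps of unitary type with labels in `I`, with `r` black
vertices, and with `ε_C = ε` and `ρ_C = ρ`, up to isomorphism. -/
def MapClass (I : Type) [LinearOrder I] (r : ℕ) (ε : I → ℤˣ) (ρ : Equiv.Perm I) : Type 1 :=
  Quotient (NondecreasingMap.setoid I r ε ρ)

/-- The permutation `φ_C` of a map considered up to isomorphism. -/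
def MapClass.phi {I : Type} [LinearOrder I] {r : ℕ} {ε : I → ℤˣ} {ρ : Equiv.Perm I}
    (C : MapClass I r ε ρ) : Equiv.Perm I :=
  Quotient.lift (s := NondecreasingMap.setoid I r ε ρ) (fun D => D.1.phi)
    (fun _ _ h => Nonempty.elim h fun e => e.phi_eq) C

/-- The set `ℭ^r_{[2m], ε_P, γ_P⁻¹}`, where `2m = deg P`. -/
abbrev MapsOf {p l : ℕ} (P : Fin l → Monomial p) (r : ℕ) : Type 1 :=
  MapClass (Fin (totalDeg P)) r (signs P) (gammaPerm P)⁻¹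

/-- The sum of `Tr_{φ_C}(M_P)` over the maps `C` in `ℭ^r_{[2m], ε_P, γ_P⁻¹}`. -/
def mapSum {N p l : ℕ} (A : Fin p → Matrix (Fin N) (Fin N) ℂ) (P : Fin l → Monomial p)
    (r : ℕ) : ℂ :=
  ∑ᶠ C : MapsOf P r, permTrace C.phi (coeffs A P)

end UnitaryMaps

end

noncomputable section

namespace UnitaryMaps

open MeasureTheory

/-! ## Traces as sums over indices -/

section TraceSums

variable {N : ℕ}

/-! Written out over indices, both sides become sums over `x, y` of the same weights `∏ k, M k (x k)
(y k)`. On the Haar side each weight multiplies a moment of entries of `U` and `U^*`. On the side of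
maps it multiplies the number of maps whose `φ` satisfies `y = x ∘ φ`. It remains to expand the
moments of entries and to count maps.

Moments of entries. Invariance of Haar measure, differentiated in the directions `E_{a, i(last)}`
and summed over `a`, gives a Schwinger–Dyson equation (`entryMoment_recursion`). For `n` entries of
`U`, the operator `N + J` applied to the moment equals a sum of moments with one `U` and one `U^*`
fewer, where `J` is the Jucys–Murphy element, the sum of the `n - 1` transpositions that move the
last row index. For `n ≤ N` the `ℓ¹` norm of `J` is at most `n - 1 < N`, so the Neumann series
inverts `N + J` (`hasSum_of_neumann_recursion`). Iterating over `n` produces products of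
transpositions `(a_t b_t)` with `a_t < b_t` and `b_t` nondecreasing, followed by a bijection
matching the `U` with the `U^*` (`hasSum_expansionTerm`). The coefficient of a sequence of length
`r` is `(-1)^r / N^(r + n)`.

Maps. From each outgoing white half-edge a strand starts that turns left at every black vertex.
Alternation of the orientations keeps it directed, and since numbers increase along edges, all
strands can be advanced together in the order of the black vertices. Each black vertex is visited by
exactly two strands, and each strand ends at an ingoing white half-edge. Up to isomorphism a map is
therefore the same as `ρ`, the sequence `τ` of pairs of strands, and the bijection `π` from starts
to ends (`mapOfData_bijective`). An outgoing half-edge at a black vertex carries the label of its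
strand, so the value of the vertex is the larger strand of its pair, and nondecreasing maps
correspond to monotone sequences.

The face at the left of an outgoing white half-edge follows its strand, while from the end of a
strand the face runs backwards and changes strand at each black vertex. Thus `φ(s) = ρ⁻¹(π s)` and
`φ(π s) = ρ⁻¹(τ s)`, where in the last formula `τ` is the product of the transpositions. With `ρ =
γ⁻¹` these are exactly the matching conditions of the expansion (`sum_phi_indicator`).

If `u` and `u⁻¹` do not occur equally often, there is no `π`, and the moment vanishes by invariance
under multiplication by phases. -/

theorem list_ofFn_prod_apply {d : ℕ} (B : Fin (d + 1) → Matrix (Fin N) (Fin N) ℂ) (a b : Fin N) :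
    (List.ofFn B).prod a b = ∑ v : Fin d → Fin N,
      ∏ k, B k (Fin.cons (α := fun _ => Fin N) a v k) (Fin.snoc (α := fun _ => Fin N) v b k) := by
  induction d generalizing a with
  | zero => simp [List.ofFn_succ, Fin.snoc]
  | succ d ih =>
    rw [List.ofFn_succ, List.prod_cons, Matrix.mul_apply,
      ← (Fin.consEquiv fun _ : Fin (d + 1) => Fin N).sum_comp, Fintype.sum_prod_type]
    refine Finset.sum_congr rfl fun c _ => ?_
    rw [ih, Finset.mul_sum]
    refine Finset.sum_congr rfl fun v _ => ?_
    rw [Fin.prod_univ_succ (n := d + 1)]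
    congr 1
    refine Finset.prod_congr rfl fun k _ => ?_
    rw [show (Fin.consEquiv fun _ : Fin (d + 1) => Fin N) (c, v) =
      (Fin.cons (α := fun _ => Fin N) c v) from rfl]
    have h : (Fin.snoc (α := fun _ => Fin N) (Fin.cons (α := fun _ => Fin N) c v) b :
        Fin (d + 1 + 1) → Fin N) = Fin.cons (α := fun _ => Fin N) c
          (Fin.snoc (α := fun _ => Fin N) v b) :=
      (Fin.cons_snoc_eq_snoc_cons (β := Fin N) c v b).symm
    rw [h, Fin.cons_succ, Fin.cons_succ]

/-- Positivity of `d` matters: for `d = 0` the trace is `N`, whereas the sum has a single term equal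
to `1`. -/
theorem trace_list_ofFn_prod {d : ℕ} (hd : 0 < d) (B : Fin d → Matrix (Fin N) (Fin N) ℂ) :
    (List.ofFn B).prod.trace = ∑ x : Fin d → Fin N, ∏ k, B k (x k) (x (finRotate d k)) := by
  obtain ⟨d, rfl⟩ : ∃ c, d = c + 1 := ⟨d - 1, by omega⟩
  rw [← (Fin.consEquiv fun _ : Fin (d + 1) => Fin N).sum_comp, Fintype.sum_prod_type, Matrix.trace]
  refine Finset.sum_congr rfl fun a _ => ?_
  rw [Matrix.diag_apply, list_ofFn_prod_apply]
  refine Finset.sum_congr rfl fun v _ => Finset.prod_congr rfl fun k _ => ?_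
  -- The column index of each factor is the row index of the cyclically next one.
  rw [Fin.snoc_eq_cons_rotate]
  rfl

/-- Serves twice: `κ` is the set of cycles in `permTrace_eq_sum` and the set of monomials in
`prod_trace_evalPoly`. -/
theorem prod_trace_list_ofFn_prod {κ : Type} [Fintype κ] [DecidableEq κ] {d : κ → ℕ}
    (hd : ∀ c, 0 < d c) (B : (Σ c, Fin (d c)) → Matrix (Fin N) (Fin N) ℂ) :
    ∏ c, (List.ofFn fun k => B ⟨c, k⟩).prod.trace =
      ∑ x : (Σ c, Fin (d c)) → Fin N,
        ∏ q, B q (x q) (x (Equiv.Perm.sigmaCongrRight (fun c => finRotate (d c)) q)) := by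
  simp_rw [trace_list_ofFn_prod (hd _)]
  rw [Finset.prod_univ_sum, Fintype.piFinset_univ,
    ← (Equiv.piCurry fun (c : κ) (_ : Fin (d c)) => Fin N).sum_comp]
  refine Finset.sum_congr rfl fun x _ => ?_
  rw [Fintype.prod_sigma]
  rfl

/-- A representative in each cycle, together with its iterates, identifies `I` with a disjoint union
of intervals `Fin (d c)` on which `σ` acts by rotation. -/
theorem permTrace_eq_sum {I : Type} [Fintype I] [DecidableEq I] (σ : Equiv.Perm I)
    (M : I → Matrix (Fin N) (Fin N) ℂ) :
    permTrace σ M = ∑ x : I → Fin N, ∏ k, M k (x k) (x (σ k)) := by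
  classical
  let Q := Quotient (Equiv.Perm.SameCycle.setoid σ)
  let d : Q → ℕ := fun c => Function.minimalPeriod σ c.out
  have hper : ∀ i, i ∈ Function.periodicPts σ := fun i =>
    Function.Injective.mem_periodicPts σ.injective i
  have hd : ∀ c, 0 < d c := fun c => Function.minimalPeriod_pos_of_mem_periodicPts (hper _)
  let f : (Σ c, Fin (d c)) → I := fun q => (σ ^ (q.2 : ℕ)) q.1.out
  have hcl : ∀ q, (Quotient.mk (Equiv.Perm.SameCycle.setoid σ) (f q)) = q.1 := fun q => by
    rw [← Quotient.out_eq q.1]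
    exact Quotient.sound (s := Equiv.Perm.SameCycle.setoid σ)
      (Equiv.Perm.SameCycle.symm ⟨(q.2 : ℕ), by simp [f]⟩)
  have hf : Function.Bijective f := by
    constructor
    · rintro ⟨c, k⟩ ⟨c', k'⟩ h
      obtain rfl : c = c' := (hcl ⟨c, k⟩).symm.trans ((congrArg _ h).trans (hcl ⟨c', k'⟩))
      have h' : (σ ^ (k : ℕ)) c.out = (σ ^ (k' : ℕ)) c.out := h
      simp only [Equiv.Perm.coe_pow] at h'
      have := (Function.iterate_injOn_Iio_minimalPeriod (f := σ) (x := c.out)) k.2 k'.2 h'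
      rw [Fin.ext this]
    · intro i
      let c : Q := Quotient.mk (Equiv.Perm.SameCycle.setoid σ) i
      have hc : σ.SameCycle c.out i := Quotient.exact (s := Equiv.Perm.SameCycle.setoid σ)
        (Quotient.out_eq c)
      obtain ⟨n, -, hn⟩ := hc.exists_pow_eq'
      refine ⟨⟨c, ⟨n % d c, Nat.mod_lt _ (hd c)⟩⟩, ?_⟩
      simp only [f, Equiv.Perm.coe_pow] at hn ⊢
      rw [← hn]
      exact Function.iterate_mod_minimalPeriod_eq
  let e : (Σ c, Fin (d c)) ≃ I := Equiv.ofBijective f hf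
  have hrot : ∀ q, e (Equiv.Perm.sigmaCongrRight (fun c => finRotate (d c)) q) = σ (e q) := by
    rintro ⟨c, k⟩
    change (σ ^ ((finRotate (d c) k : Fin (d c)) : ℕ)) c.out = σ ((σ ^ (k : ℕ)) c.out)
    rw [← Equiv.Perm.mul_apply, ← pow_succ']
    generalize hD : d c = D at k
    obtain ⟨n, rfl⟩ : ∃ n, D = n + 1 := ⟨D - 1, by have := k.2; omega⟩
    rw [coe_finRotate]
    split_ifs with hk
    -- The rotation wraps to `0` here, which agrees with `σ` because `d c` is the period of the
    -- representative.
    · subst hk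
      simp only [Fin.val_last, pow_zero, Equiv.Perm.one_apply, Equiv.Perm.coe_pow]
      rw [← hD]
      exact (Function.isPeriodicPt_minimalPeriod σ _).symm
    · rfl
  have h1 : permTrace σ M = ∏ c : Q, (List.ofFn fun k => M (e ⟨c, k⟩)).prod.trace := by
    unfold permTrace
    refine Finset.prod_congr rfl fun c _ => ?_
    conv_lhs => rw [← Quotient.out_eq c]
    rfl
  rw [h1, prod_trace_list_ofFn_prod hd (fun q => M (e q)), ← (e.arrowCongr (Equiv.refl _)).sum_comp]
  refine Finset.sum_congr rfl fun x _ => ?_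
  rw [← e.prod_comp]
  refine Finset.prod_congr rfl fun q _ => ?_
  rw [← hrot]
  simp [Equiv.arrowCongr]

/-- The matrices `U` and `U^*` associated with the signs `1` and `-1`. -/
def signPow (U : Matrix (Fin N) (Fin N) ℂ) (s : ℤˣ) : Matrix (Fin N) (Fin N) ℂ :=
  if s = 1 then U else U.conjTranspose

theorem evalPoly_toPoly {p : ℕ} (A : Fin p → Matrix (Fin N) (Fin N) ℂ)
    (U : Matrix (Fin N) (Fin N) ℂ) (P : Monomial p) :
    evalPoly A U P.toPoly = (List.ofFn fun j =>
      ((P.word j).map (CoeffLetter.toMatrix A)).prod * signPow U (P.sign j)).prod := by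
  unfold Monomial.toPoly
  rw [map_list_prod, List.map_ofFn]
  congr 2
  funext j
  simp only [Function.comp_apply, map_mul, map_list_prod, List.map_map, evalPoly,
    FreeAlgebra.lift_ι_apply]
  congr 1
  · congr 1
    refine List.map_congr_left fun x _ => ?_
    simp [Letter.toMatrix]
  · unfold signPow
    split_ifs <;> rfl

theorem prod_trace_evalPoly {p l : ℕ} (A : Fin p → Matrix (Fin N) (Fin N) ℂ)
    (U : Matrix (Fin N) (Fin N) ℂ) (P : Fin l → Monomial p) :
    ∏ i, (evalPoly A U (P i).toPoly).trace = ∑ x : Fin (totalDeg P) → Fin N,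
      ∏ k, (coeffs A P k * signPow U (signs P k)) (x k) (x (gammaPerm P k)) := by
  simp_rw [evalPoly_toPoly]
  let e : (Σ i, Fin (P i).deg) ≃ Fin (totalDeg P) := finSigmaFinEquiv
  have h := prod_trace_list_ofFn_prod (N := N) (fun i => (P i).deg_pos)
    (fun q => coeffs A P (e q) * signPow U (signs P (e q)))
  have h2 : ∀ q, coeffs A P (e q) * signPow U (signs P (e q)) =
      (((P q.1).word q.2).map (CoeffLetter.toMatrix A)).prod * signPow U ((P q.1).sign q.2) := by
    intro q
    have hq := Equiv.symm_apply_apply e q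
    simp only [coeffs, signs]
    change (((P (e.symm (e q)).1).word (e.symm (e q)).2).map _).prod *
      signPow U ((P (e.symm (e q)).1).sign (e.symm (e q)).2) = _
    rw [hq]
  have h3 : ∀ i, (List.ofFn fun j => (((P i).word j).map (CoeffLetter.toMatrix A)).prod *
      signPow U ((P i).sign j)).prod.trace = (List.ofFn fun j => coeffs A P (e ⟨i, j⟩) *
      signPow U (signs P (e ⟨i, j⟩))).prod.trace := fun i => by
    congr 3
    funext j
    exact (h2 ⟨i, j⟩).symm
  simp_rw [h3]
  rw [h, ← (e.arrowCongr (Equiv.refl _)).sum_comp]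
  refine Finset.sum_congr rfl fun x _ => ?_
  rw [← e.prod_comp]
  refine Finset.prod_congr rfl fun q _ => ?_
  simp [Equiv.arrowCongr, gammaPerm, Equiv.permCongr_apply, e]

/-- Separates the deterministic coefficients from the entries of `B`, with independent row and
column indices for each `M k`. -/
theorem sum_prod_mul_apply {I : Type} [Fintype I] [DecidableEq I]
    (M B : I → Matrix (Fin N) (Fin N) ℂ) (γ : I → I) :
    ∑ x : I → Fin N, ∏ k, (M k * B k) (x k) (x (γ k)) =
      ∑ x : I → Fin N, ∑ y : I → Fin N, (∏ k, M k (x k) (y k)) * ∏ k, B k (y k) (x (γ k)) := by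
  refine Finset.sum_congr rfl fun x _ => ?_
  simp_rw [Matrix.mul_apply]
  rw [Finset.prod_univ_sum, Fintype.piFinset_univ]
  exact Finset.sum_congr rfl fun y _ => Finset.prod_mul_distrib

end TraceSums

/-! ## Schwinger–Dyson equations for the Haar measure -/

section SchwingerDyson

variable {N : ℕ}

instance : (haarUnitary N).IsHaarMeasure := by unfold haarUnitary; infer_instance

instance : IsProbabilityMeasure (haarUnitary N) :=
  ⟨Measure.haarMeasure_self (K₀ :=
    (⊤ : TopologicalSpace.PositiveCompacts (Matrix.unitaryGroup (Fin N) ℂ)))⟩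

theorem integrable_haarUnitary {f : Matrix.unitaryGroup (Fin N) ℂ → ℂ} (hf : Continuous f) :
    Integrable f (haarUnitary N) :=
  hf.integrable_of_hasCompactSupport (HasCompactSupport.of_compactSpace f)

/-- The integral of the derivative along a left-invariant flow vanishes. -/
theorem integral_flow_derivative_eq_zero (g : ℝ → Matrix.unitaryGroup (Fin N) ℂ) (g0 : g 0 = 1)
    {f D : Matrix.unitaryGroup (Fin N) ℂ → ℂ} (hf : Continuous f) (hD : Continuous D)
    (h : ∀ t U, HasDerivAt (fun t => f (g t * U)) (D (g t * U)) t) :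
    ∫ U, D U ∂(haarUnitary N) = 0 := by
  -- Compactness of the group gives a constant dominating the derivative, which allows
  -- differentiation under the integral; by invariance the integral is constant in `t`.
  obtain ⟨K, hK⟩ := isCompact_univ.exists_bound_of_continuousOn hD.continuousOn
  have key := (hasDerivAt_integral_of_dominated_loc_of_deriv_le (μ := haarUnitary N)
    (F := fun t U => f (g t * U)) (F' := fun t U => D (g t * U)) (x₀ := (0 : ℝ)) (s := Set.univ)
    (bound := fun _ => K) Filter.univ_mem
    (Filter.Eventually.of_forall fun t =>
      (integrable_haarUnitary (hf.comp (continuous_const_mul (g t)))).aestronglyMeasurable)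
    (integrable_haarUnitary (hf.comp (continuous_const_mul (g 0))))
    (integrable_haarUnitary (hD.comp (continuous_const_mul (g 0)))).aestronglyMeasurable
    (Filter.Eventually.of_forall fun U t _ => hK _ (Set.mem_univ _))
    (integrable_const K)
    (Filter.Eventually.of_forall fun U t _ => h t U)).2
  have hconst : (fun t => ∫ U, f (g t * U) ∂(haarUnitary N)) =
      fun _ => ∫ U, f U ∂(haarUnitary N) := by
    funext t
    exact integral_mul_left_eq_self f (g t)
  rw [hconst] at key
  have := key.unique (hasDerivAt_const _ _)
  simpa [g0] using this

theorem hasDerivAt_matrix_exp_apply (X : Matrix (Fin N) (Fin N) ℂ) (t : ℝ) (a b : Fin N) :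
    HasDerivAt (fun t : ℝ => NormedSpace.exp (t • X) a b)
      ((X * NormedSpace.exp (t • X)) a b) t := by
  open scoped Matrix.Norms.Operator in
  exact hasDerivAt_pi.1 (hasDerivAt_pi.1 (hasDerivAt_exp_smul_const' (𝕂 := ℝ) X t) a) b

/-- The one-parameter group of unitary matrices generated by a skew-Hermitian matrix. -/
def expUnitaryGroup (X : Matrix (Fin N) (Fin N) ℂ) (hX : X.conjTranspose = -X) (t : ℝ) :
    Matrix.unitaryGroup (Fin N) ℂ :=
  ⟨NormedSpace.exp (t • X), by
    have h : (t • X).conjTranspose = -(t • X) := by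
      rw [Matrix.conjTranspose_smul, hX]
      simp
    rw [Matrix.mem_unitaryGroup_iff, Matrix.star_eq_conjTranspose, ← Matrix.exp_conjTranspose, h,
      ← Matrix.exp_add_of_commute _ _ (Commute.refl (t • X)).neg_right, add_neg_cancel,
      NormedSpace.exp_zero]⟩

variable {ι κ : Type} [Fintype ι] [Fintype κ]

/-- The product of the entries `U (i s) (j s)` and `Uᴴ (j' s) (i' s)`. -/
def entryProd (i j : ι → Fin N) (i' j' : κ → Fin N) (U : Matrix (Fin N) (Fin N) ℂ) : ℂ :=
  (∏ s, U (i s) (j s)) * ∏ s, U.conjTranspose (j' s) (i' s)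

/-- The Haar moment of matrix entries. -/
def entryMoment (i j : ι → Fin N) (i' j' : κ → Fin N) : ℂ :=
  ∫ U : Matrix.unitaryGroup (Fin N) ℂ, entryProd i j i' j' (U : Matrix (Fin N) (Fin N) ℂ)
    ∂(haarUnitary N)

theorem continuous_entry (a b : Fin N) :
    Continuous fun U : Matrix.unitaryGroup (Fin N) ℂ => (U : Matrix (Fin N) (Fin N) ℂ) a b :=
  (continuous_apply_apply a b).comp continuous_subtype_val

theorem continuous_mul_entry (X : Matrix (Fin N) (Fin N) ℂ) (a b : Fin N) :
    Continuous fun U : Matrix.unitaryGroup (Fin N) ℂ =>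
      (X * (U : Matrix (Fin N) (Fin N) ℂ)) a b := by
  simp_rw [Matrix.mul_apply]
  exact continuous_finsetSum _ fun c _ => continuous_const.mul (continuous_entry c b)

theorem continuous_conj_entry (a b : Fin N) :
    Continuous fun U : Matrix.unitaryGroup (Fin N) ℂ =>
      (U : Matrix (Fin N) (Fin N) ℂ).conjTranspose a b :=
  (continuous_entry b a).star

theorem continuous_conj_entry_mul (X : Matrix (Fin N) (Fin N) ℂ) (a b : Fin N) :
    Continuous fun U : Matrix.unitaryGroup (Fin N) ℂ =>
      ((U : Matrix (Fin N) (Fin N) ℂ).conjTranspose * X) a b := by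
  simp_rw [Matrix.mul_apply]
  exact continuous_finsetSum _ fun c _ => (continuous_conj_entry a c).mul continuous_const

theorem continuous_entryProd (i j : ι → Fin N) (i' j' : κ → Fin N) :
    Continuous fun U : Matrix.unitaryGroup (Fin N) ℂ =>
      entryProd i j i' j' (U : Matrix (Fin N) (Fin N) ℂ) :=
  (continuous_finsetProd _ fun _ _ => continuous_entry _ _).mul
    (continuous_finsetProd _ fun _ _ => continuous_conj_entry _ _)

variable [DecidableEq ι] [DecidableEq κ]

/-- The derivative of `entryProd` in the direction `X * U`, for skew-Hermitian `X`. -/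
def entryProdDeriv (i j : ι → Fin N) (i' j' : κ → Fin N) (X U : Matrix (Fin N) (Fin N) ℂ) : ℂ :=
  (∑ k, (∏ s ∈ Finset.univ.erase k, U (i s) (j s)) * (X * U) (i k) (j k)) *
      (∏ s, U.conjTranspose (j' s) (i' s)) -
    (∏ s, U (i s) (j s)) * ∑ k, (∏ s ∈ Finset.univ.erase k, U.conjTranspose (j' s) (i' s)) *
      (U.conjTranspose * X) (j' k) (i' k)

theorem continuous_entryProdDeriv (i j : ι → Fin N) (i' j' : κ → Fin N)
    (X : Matrix (Fin N) (Fin N) ℂ) :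
    Continuous fun U : Matrix.unitaryGroup (Fin N) ℂ =>
      entryProdDeriv i j i' j' X (U : Matrix (Fin N) (Fin N) ℂ) := by
  refine Continuous.sub (Continuous.mul (continuous_finsetSum _ fun k _ => Continuous.mul
    (continuous_finsetProd _ fun _ _ => continuous_entry _ _) (continuous_mul_entry _ _ _))
    (continuous_finsetProd _ fun _ _ => continuous_conj_entry _ _))
    (Continuous.mul (continuous_finsetProd _ fun _ _ => continuous_entry _ _)
    (continuous_finsetSum _ fun k _ => Continuous.mul
    (continuous_finsetProd _ fun _ _ => continuous_conj_entry _ _)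
    (continuous_conj_entry_mul _ _ _)))

/-- Complex linearity in the direction extends the vanishing of the integral from skew-Hermitian
directions, which generate flows in the group, to all matrices. -/
theorem entryProdDeriv_add_smul (i j : ι → Fin N) (i' j' : κ → Fin N)
    (X Y U : Matrix (Fin N) (Fin N) ℂ) (c : ℂ) :
    entryProdDeriv i j i' j' (X + c • Y) U =
      entryProdDeriv i j i' j' X U + c * entryProdDeriv i j i' j' Y U := by
  simp only [entryProdDeriv, Matrix.add_mul, Matrix.add_apply, Matrix.smul_mul,
    Matrix.mul_smul, Matrix.smul_apply, smul_eq_mul, mul_add, Finset.sum_add_distrib]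
  simp only [mul_left_comm _ c, ← Finset.mul_sum]
  ring

/-- Along `t ↦ exp(tX) U` the derivative of `U` is `X U`, and that of `U^*` is `(X U)^* = -U^* X` as
`X` is skew-Hermitian; the product rule then gives `entryProdDeriv`. -/
theorem integral_entryProdDeriv_of_skew (i j : ι → Fin N) (i' j' : κ → Fin N)
    (X : Matrix (Fin N) (Fin N) ℂ) (hX : X.conjTranspose = -X) :
    ∫ U : Matrix.unitaryGroup (Fin N) ℂ, entryProdDeriv i j i' j' X
      (U : Matrix (Fin N) (Fin N) ℂ) ∂(haarUnitary N) = 0 := by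
  refine integral_flow_derivative_eq_zero (expUnitaryGroup X hX)
    (Subtype.ext (by simp [expUnitaryGroup]))
    (continuous_entryProd i j i' j') (continuous_entryProdDeriv i j i' j' X) fun t U => ?_
  have h1 : ∀ a b, HasDerivAt (fun t : ℝ =>
      ((expUnitaryGroup X hX t * U : Matrix.unitaryGroup (Fin N) ℂ) :
        Matrix (Fin N) (Fin N) ℂ) a b)
      ((X * ((expUnitaryGroup X hX t * U : Matrix.unitaryGroup (Fin N) ℂ) :
        Matrix (Fin N) (Fin N) ℂ)) a b) t := by
    intro a b
    have : (X * ((expUnitaryGroup X hX t * U : Matrix.unitaryGroup (Fin N) ℂ) :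
        Matrix (Fin N) (Fin N) ℂ)) a b = ∑ c, (X * NormedSpace.exp (t • X)) a c * U.1 c b := by
      change (X * (NormedSpace.exp (t • X) * U.1)) a b = _
      rw [← Matrix.mul_assoc, Matrix.mul_apply]
    rw [this]
    change HasDerivAt (fun t : ℝ => (NormedSpace.exp (t • X) * U.1) a b) _ t
    simp_rw [Matrix.mul_apply (M := NormedSpace.exp _)]
    exact HasDerivAt.fun_sum fun c _ => (hasDerivAt_matrix_exp_apply X t a c).mul_const _
  have h2 : ∀ a b, HasDerivAt (fun t : ℝ =>
      ((expUnitaryGroup X hX t * U : Matrix.unitaryGroup (Fin N) ℂ) :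
        Matrix (Fin N) (Fin N) ℂ).conjTranspose a b)
      (-(((expUnitaryGroup X hX t * U : Matrix.unitaryGroup (Fin N) ℂ) :
        Matrix (Fin N) (Fin N) ℂ).conjTranspose * X) a b) t := by
    intro a b
    have := (h1 b a).star
    rw [← Matrix.conjTranspose_apply, Matrix.conjTranspose_mul, hX, Matrix.mul_neg,
      Matrix.neg_apply] at this
    exact this
  have h3 := (HasDerivAt.fun_finsetProd (u := Finset.univ) fun s _ => h1 (i s) (j s)).mul
    (HasDerivAt.fun_finsetProd (u := Finset.univ) fun s _ => h2 (j' s) (i' s))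
  convert! h3 using 1
  simp only [entryProdDeriv, smul_eq_mul, mul_neg, Finset.sum_neg_distrib]
  ring

theorem integral_entryProdDeriv (i j : ι → Fin N) (i' j' : κ → Fin N)
    (X : Matrix (Fin N) (Fin N) ℂ) :
    ∫ U : Matrix.unitaryGroup (Fin N) ℂ, entryProdDeriv i j i' j' X
      (U : Matrix (Fin N) (Fin N) ℂ) ∂(haarUnitary N) = 0 := by
  -- `X = A - i B` with both `A` and `B` skew-Hermitian.
  let A : Matrix (Fin N) (Fin N) ℂ := (1 / 2 : ℂ) • (X - X.conjTranspose)
  let B : Matrix (Fin N) (Fin N) ℂ := (Complex.I / 2) • (X + X.conjTranspose)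
  have hA : A.conjTranspose = -A := by
    ext a b
    simp [A]
    ring
  have hB : B.conjTranspose = -B := by
    ext a b
    simp [B]
    ring
  have hX : X = A + (-Complex.I) • B := by
    ext a b
    simp only [A, B, Matrix.add_apply, Matrix.smul_apply, Matrix.sub_apply, smul_eq_mul]
    linear_combination (X a b + X.conjTranspose a b) / 2 * Complex.I_mul_I
  rw [hX]
  simp_rw [entryProdDeriv_add_smul]
  rw [integral_add (integrable_haarUnitary (continuous_entryProdDeriv _ _ _ _ _))
    ((integrable_haarUnitary (continuous_entryProdDeriv _ _ _ _ _)).const_mul _),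
    integral_const_mul, integral_entryProdDeriv_of_skew _ _ _ _ _ hA,
    integral_entryProdDeriv_of_skew _ _ _ _ _ hB]
  simp

/-- Unbalanced moments vanish. -/
theorem entryMoment_eq_zero_of_card_ne (i j : ι → Fin N) (i' j' : κ → Fin N)
    (h : Fintype.card ι ≠ Fintype.card κ) : entryMoment i j i' j' = 0 := by
  -- The identity direction is, up to the factor `i`, the generator of phases; it multiplies the
  -- product by the difference of the two degrees.
  have key := integral_entryProdDeriv i j i' j' 1
  have : ∀ U, entryProdDeriv i j i' j' 1 U =
      ((Fintype.card ι : ℂ) - Fintype.card κ) * entryProd i j i' j' U := by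
    intro U
    simp only [entryProdDeriv, Matrix.one_mul, Matrix.mul_one, Finset.prod_erase_mul _ _
      (Finset.mem_univ _), Finset.sum_const, Finset.card_univ, nsmul_eq_mul, entryProd]
    ring
  simp_rw [this] at key
  rw [integral_const_mul] at key
  refine (mul_eq_zero.1 key).resolve_left ?_
  exact sub_ne_zero.2 (by exact_mod_cast h)

end SchwingerDyson

/-! ## The recursion for moments of entries -/

section MomentRecursion

variable {N : ℕ}

theorem prod_erase_eq_prod_ite {ι : Type} [Fintype ι] [DecidableEq ι] (f : ι → ℂ) (k : ι) :
    ∏ s ∈ Finset.univ.erase k, f s = ∏ s, if s = k then 1 else f s := by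
  rw [Finset.prod_ite, Finset.prod_const_one, one_mul, Finset.filter_ne']

theorem prod_erase_succAbove {m : ℕ} (f : Fin (m + 1) → ℂ) (k : Fin (m + 1)) :
    ∏ s ∈ Finset.univ.erase k, f s = ∏ s : Fin m, f (k.succAbove s) := by
  rw [prod_erase_eq_prod_ite, Fin.prod_univ_succAbove _ k]
  simp

theorem prod_erase_last {m : ℕ} (f : Fin (m + 1) → ℂ) :
    ∏ s ∈ Finset.univ.erase (Fin.last m), f s = ∏ s : Fin m, f s.castSucc := by
  rw [prod_erase_succAbove]
  simp

theorem prod_erase_castSucc {m : ℕ} (f : Fin (m + 1) → ℂ) (k : Fin m) :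
    ∏ s ∈ Finset.univ.erase k.castSucc, f s =
      (∏ s ∈ Finset.univ.erase k, f s.castSucc) * f (Fin.last m) := by
  rw [prod_erase_eq_prod_ite, Fin.prod_univ_castSucc, prod_erase_eq_prod_ite,
    if_neg (Fin.castSucc_lt_last k).ne']
  simp

theorem prod_swap_last {m : ℕ} (i j : Fin (m + 1) → Fin N) (U : Matrix (Fin N) (Fin N) ℂ)
    (k : Fin m) :
    ∏ s, U ((i ∘ Equiv.swap k.castSucc (Fin.last m)) s) (j s) =
      (∏ s ∈ Finset.univ.erase k, U (i s.castSucc) (j s.castSucc)) *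
        U (i k.castSucc) (j (Fin.last m)) * U (i (Fin.last m)) (j k.castSucc) := by
  rw [Fin.prod_univ_castSucc, ← Finset.prod_erase_mul _ _ (Finset.mem_univ k)]
  have : ∀ s ∈ Finset.univ.erase k,
      U ((i ∘ Equiv.swap k.castSucc (Fin.last m)) s.castSucc) (j s.castSucc) =
        U (i s.castSucc) (j s.castSucc) := fun s hs => by
    rw [Function.comp_apply, Equiv.swap_apply_of_ne_of_ne
      (fun h => Finset.ne_of_mem_erase hs (Fin.castSucc_injective _ h))
      (Fin.castSucc_lt_last s).ne]
  rw [Finset.prod_congr rfl this]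
  simp only [Function.comp_apply, Equiv.swap_apply_left, Equiv.swap_apply_right]
  ring

/-- The product rule has three kinds of terms. Differentiating the last `U` restores the entry `i
(last)` for each of the `N` values of `a`. Differentiating the `k`-th `U` forces `a = i k` and
exchanges the row indices of `k` and of the last factor. Differentiating the `k`-th `U^*` leaves a
sum over `a` that `U^* U = 1` contracts, which removes one factor of each kind. -/
theorem sum_entryProdDeriv {m : ℕ} (i j i' j' : Fin (m + 1) → Fin N)
    (U : Matrix (Fin N) (Fin N) ℂ) (hU : U.conjTranspose * U = 1) :
    ∑ a, entryProdDeriv (Function.update i (Fin.last m) a) j i' j'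
        (Matrix.single a (i (Fin.last m)) 1) U =
      (N : ℂ) * entryProd i j i' j' U +
        ∑ k : Fin m, entryProd (i ∘ Equiv.swap k.castSucc (Fin.last m)) j i' j' U -
        ∑ k, if i (Fin.last m) = i' k ∧ j (Fin.last m) = j' k then
          entryProd (i ∘ Fin.castSucc) (j ∘ Fin.castSucc) (i' ∘ k.succAbove) (j' ∘ k.succAbove) U
          else 0 := by
  have hs1 : ∀ (a b x y : Fin N), (Matrix.single a b (1 : ℂ) * U) x y =
      if x = a then U b y else 0 := by
    intro a b x y
    simp [Matrix.mul_apply, Matrix.single_apply, ite_and, eq_comm]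
  have hs2 : ∀ (a b x y : Fin N), (U.conjTranspose * Matrix.single a b (1 : ℂ)) x y =
      if y = b then U.conjTranspose x a else 0 := by
    intro a b x y
    simp [Matrix.mul_apply, Matrix.single_apply, ite_and, eq_comm]
  have hne : ∀ s : Fin m, s.castSucc ≠ Fin.last m := fun s => (Fin.castSucc_lt_last s).ne
  simp only [entryProdDeriv, hs1, hs2, Finset.sum_sub_distrib, ← Finset.sum_mul]
  congr 1
  · rw [Finset.sum_comm, Fin.sum_univ_castSucc, add_comm, add_mul]
    congr 1
    · simp only [prod_erase_last, Function.update_self, if_true, Function.update_of_ne (hne _)]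
      simp only [Finset.sum_const, Finset.card_univ, Fintype.card_fin, nsmul_eq_mul, entryProd]
      rw [Fin.prod_univ_castSucc (f := fun s => U (i s) (j s))]
      ring
    · rw [Finset.sum_mul]
      refine Finset.sum_congr rfl fun k _ => ?_
      simp only [prod_erase_castSucc, Function.update_self, Function.update_of_ne (hne _)]
      simp only [mul_ite, mul_zero, Finset.sum_ite_eq, Finset.mem_univ, if_true]
      rw [entryProd, prod_swap_last]
  · simp only [Fin.prod_univ_castSucc (n := m), Function.update_self,
      Function.update_of_ne (hne _), Finset.mul_sum]
    rw [Finset.sum_comm]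
    refine Finset.sum_congr rfl fun k _ => ?_
    have horth : ∑ a, U.conjTranspose (j' k) a * U a (j (Fin.last m)) =
        if j (Fin.last m) = j' k then 1 else 0 := by
      rw [← Matrix.mul_apply, hU, Matrix.one_apply]
      simp [eq_comm]
    by_cases h : i (Fin.last m) = i' k
    · simp only [h, if_true, true_and]
      have : ∀ a, (∏ s : Fin m, U (i s.castSucc) (j s.castSucc)) * U a (j (Fin.last m)) *
          ((∏ s ∈ Finset.univ.erase k, U.conjTranspose (j' s) (i' s)) *
            U.conjTranspose (j' k) a) =
          ((∏ s : Fin m, U (i s.castSucc) (j s.castSucc)) *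
            (∏ s ∈ Finset.univ.erase k, U.conjTranspose (j' s) (i' s))) *
            (U.conjTranspose (j' k) a * U a (j (Fin.last m))) := fun a => by ring
      simp_rw [this]
      rw [← Finset.mul_sum, horth, mul_ite, mul_one, mul_zero, prod_erase_succAbove]
      rfl
    · have h' : ¬ i' k = i (Fin.last m) := fun hc => h hc.symm
      simp [h, h']

/-- The left side is `N` plus the Jucys–Murphy element of the last index acting on the row indices;
the right side has lower degree, so the moments can be found by induction once the left operator is
inverted. -/
theorem entryMoment_recursion {m : ℕ} (i j i' j' : Fin (m + 1) → Fin N) :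
    (N : ℂ) * entryMoment i j i' j' +
        ∑ k : Fin m, entryMoment (i ∘ Equiv.swap k.castSucc (Fin.last m)) j i' j' =
      ∑ k, if i (Fin.last m) = i' k ∧ j (Fin.last m) = j' k then
        entryMoment (i ∘ Fin.castSucc) (j ∘ Fin.castSucc) (i' ∘ k.succAbove) (j' ∘ k.succAbove)
        else 0 := by
  have hint : ∀ {ι κ : Type} [Fintype ι] [Fintype κ] (i j : ι → Fin N) (i' j' : κ → Fin N),
      Integrable (fun U : Matrix.unitaryGroup (Fin N) ℂ =>
        entryProd i j i' j' (U : Matrix (Fin N) (Fin N) ℂ)) (haarUnitary N) :=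
    fun i j i' j' => integrable_haarUnitary (continuous_entryProd i j i' j')
  have key : ∫ U : Matrix.unitaryGroup (Fin N) ℂ,
      ∑ a, entryProdDeriv (Function.update i (Fin.last m) a) j i' j'
        (Matrix.single a (i (Fin.last m)) 1) (U : Matrix (Fin N) (Fin N) ℂ)
        ∂(haarUnitary N) = 0 := by
    rw [integral_finsetSum _ fun a _ =>
      integrable_haarUnitary (continuous_entryProdDeriv _ _ _ _ _)]
    exact Finset.sum_eq_zero fun a _ => integral_entryProdDeriv _ _ _ _ _
  have hint2 : ∀ k : Fin (m + 1), Integrable (fun U : Matrix.unitaryGroup (Fin N) ℂ =>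
      if i (Fin.last m) = i' k ∧ j (Fin.last m) = j' k then
        entryProd (i ∘ Fin.castSucc) (j ∘ Fin.castSucc) (i' ∘ k.succAbove) (j' ∘ k.succAbove)
        (U : Matrix (Fin N) (Fin N) ℂ) else 0) (haarUnitary N) := fun k => by
    split_ifs
    · exact hint _ _ _ _
    · exact integrable_zero _ _ _
  have hint3 : Integrable (fun U : Matrix.unitaryGroup (Fin N) ℂ =>
      (N : ℂ) * entryProd i j i' j' (U : Matrix (Fin N) (Fin N) ℂ)) (haarUnitary N) :=
    (hint _ _ _ _).const_mul _
  have hint4 : Integrable (fun U : Matrix.unitaryGroup (Fin N) ℂ => ∑ k : Fin m,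
      entryProd (i ∘ Equiv.swap k.castSucc (Fin.last m)) j i' j'
        (U : Matrix (Fin N) (Fin N) ℂ)) (haarUnitary N) :=
    integrable_finsetSum _ fun k _ => hint _ _ _ _
  have hint5 : Integrable (fun U : Matrix.unitaryGroup (Fin N) ℂ =>
      (N : ℂ) * entryProd i j i' j' (U : Matrix (Fin N) (Fin N) ℂ) + ∑ k : Fin m,
      entryProd (i ∘ Equiv.swap k.castSucc (Fin.last m)) j i' j'
        (U : Matrix (Fin N) (Fin N) ℂ)) (haarUnitary N) := hint3.add hint4
  simp_rw [sum_entryProdDeriv i j i' j' _ (Matrix.mem_unitaryGroup_iff'.1 (Subtype.prop _))] at key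
  rw [integral_sub hint5 (integrable_finsetSum _ fun k _ => hint2 k),
    integral_add hint3 hint4,
    integral_const_mul, integral_finsetSum _ fun k _ => hint _ _ _ _,
    integral_finsetSum _ fun k _ => hint2 k, sub_eq_zero] at key
  unfold entryMoment
  rw [key]
  refine Finset.sum_congr rfl fun k _ => ?_
  split_ifs <;> simp

end MomentRecursion

/-! ## Solving a linear recursion by a Neumann series -/

section Neumann

/-- Each `sw k` permutes `T`, so `F ↦ ∑ k, F (sw k ·)` has `ℓ¹` norm at most `m < N`. The `X r` are
the graded pieces of the Neumann solution of the equation that `E` solves with right side `∑ R r`.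
The norm bound gives both absolute convergence and uniqueness of the solution. -/
theorem hasSum_of_neumann_recursion {T : Type} [Fintype T] {m N : ℕ} (hmN : m < N)
    (sw : Fin m → Equiv.Perm T) (X R : ℕ → T → ℂ) (E : T → ℂ)
    (h0 : ∀ t, (N : ℂ) * X 0 t = R 0 t)
    (h1 : ∀ r t, (N : ℂ) * X (r + 1) t + ∑ k, X r (sw k t) = R (r + 1) t)
    (hR : ∀ t, Summable fun r => ‖R r t‖)
    (hE : ∀ t, HasSum (fun r => R r t) ((N : ℂ) * E t + ∑ k, E (sw k t))) (t : T) :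
    Summable (fun r => ‖X r t‖) ∧ HasSum (fun r => X r t) (E t) := by
  have hpos : (0 : ℝ) < (N : ℝ) - m := sub_pos.2 (by exact_mod_cast hmN)
  have hsw : ∀ (F : T → ℂ), ∑ t, ∑ k, ‖F (sw k t)‖ = m * ∑ t, ‖F t‖ := by
    intro F
    rw [Finset.sum_comm]
    simp_rw [fun k => Equiv.sum_comp (sw k) fun t => ‖F t‖]
    simp
  have hsumR : Summable fun r => ∑ t, ‖R r t‖ := summable_sum fun t _ => hR t
  have hstep : ∀ r, (N : ℝ) * ∑ t, ‖X (r + 1) t‖ ≤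
      m * ∑ t, ‖X r t‖ + ∑ t, ‖R (r + 1) t‖ := by
    intro r
    rw [← hsw, ← Finset.sum_add_distrib, Finset.mul_sum]
    refine Finset.sum_le_sum fun t _ => ?_
    have : (N : ℂ) * X (r + 1) t = R (r + 1) t - ∑ k, X r (sw k t) := eq_sub_of_add_eq (h1 r t)
    calc (N : ℝ) * ‖X (r + 1) t‖ = ‖(N : ℂ) * X (r + 1) t‖ := by simp
      _ ≤ ‖R (r + 1) t‖ + ‖∑ k, X r (sw k t)‖ := by rw [this]; exact norm_sub_le _ _
      _ ≤ ‖R (r + 1) t‖ + ∑ k, ‖X r (sw k t)‖ := by gcongr; exact norm_sum_le _ _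
      _ = _ := add_comm _ _
  have hfirst : (N : ℝ) * ∑ t, ‖X 0 t‖ = ∑ t, ‖R 0 t‖ := by
    rw [Finset.mul_sum]
    exact Finset.sum_congr rfl fun t _ => by rw [← h0]; simp
  have hpart : ∀ n, (N : ℝ) * ∑ r ∈ Finset.range (n + 1), ∑ t, ‖X r t‖ ≤
      m * ∑ r ∈ Finset.range n, ∑ t, ‖X r t‖ +
        ∑ r ∈ Finset.range (n + 1), ∑ t, ‖R r t‖ := by
    intro n
    induction n with
    | zero => simp [hfirst]
    | succ n ih =>
      have e1 : (m : ℝ) * ∑ r ∈ Finset.range (n + 1), ∑ t, ‖X r t‖ =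
          m * ∑ r ∈ Finset.range n, ∑ t, ‖X r t‖ + m * ∑ t, ‖X n t‖ := by
        rw [Finset.sum_range_succ, mul_add]
      rw [Finset.sum_range_succ, mul_add, e1, Finset.sum_range_succ _ (n + 1)]
      linarith [hstep n]
  have hXsum : Summable fun r => ∑ t, ‖X r t‖ := by
    -- The constant comes from absorbing `m` times the partial sum into the left side of `hpart`.
    refine summable_of_sum_range_le (c := (∑' r, ∑ t, ‖R r t‖) / ((N : ℝ) - m))
      (fun r => Finset.sum_nonneg fun t _ => norm_nonneg _) fun n => ?_
    rw [le_div_iff₀ hpos]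
    have hmono : ∑ r ∈ Finset.range n, ∑ t, ‖X r t‖ ≤
        ∑ r ∈ Finset.range (n + 1), ∑ t, ‖X r t‖ := by
      rw [Finset.sum_range_succ]
      exact le_add_of_nonneg_right (Finset.sum_nonneg fun t _ => norm_nonneg _)
    have hle : ∑ r ∈ Finset.range (n + 1), ∑ t, ‖R r t‖ ≤ ∑' r, ∑ t, ‖R r t‖ :=
      hsumR.sum_le_tsum _ fun r _ => Finset.sum_nonneg fun t _ => norm_nonneg _
    nlinarith [hpart n, hmono, (Nat.cast_nonneg N : (0 : ℝ) ≤ N)]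
  have hXs : ∀ t, Summable fun r => ‖X r t‖ := fun t =>
    Summable.of_nonneg_of_le (fun r => norm_nonneg _) (fun r =>
      Finset.single_le_sum (f := fun t => ‖X r t‖) (fun t _ => norm_nonneg _)
        (Finset.mem_univ t)) hXsum
  refine ⟨hXs t, ?_⟩
  let Y : T → ℂ := fun t => ∑' r, X r t
  have hY : ∀ t, HasSum (fun r => X r t) (Y t) := fun t => (hXs t).of_norm.hasSum
  have hYeq : ∀ t, (N : ℂ) * Y t + ∑ k, Y (sw k t) = (N : ℂ) * E t + ∑ k, E (sw k t) := by
    intro t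
    -- The term of index `0` is split off because `h1` only concerns the indices `r + 1`.
    have ha : HasSum (fun r => (N : ℂ) * X (r + 1) t) ((N : ℂ) * Y t - R 0 t) := by
      have := ((hY t).mul_left (N : ℂ))
      rw [← hasSum_nat_add_iff' 1] at this
      simpa [h0] using this
    have hb : HasSum (fun r => ∑ k, X r (sw k t)) (∑ k, Y (sw k t)) :=
      hasSum_sum fun k _ => hY (sw k t)
    have hc := ha.add hb
    simp_rw [h1] at hc
    have hd := hE t
    rw [← hasSum_nat_add_iff' 1] at hd
    have := hc.unique hd
    simp only [Finset.sum_range_one] at this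
    linear_combination this
  -- The difference of two solutions has a norm `d` with `N d ≤ m d`, hence `d = 0`.
  have hzero : ∑ t, ‖E t - Y t‖ = 0 := by
    have hle : (N : ℝ) * ∑ t, ‖E t - Y t‖ ≤ m * ∑ t, ‖E t - Y t‖ := by
      rw [← hsw (fun t => E t - Y t), Finset.mul_sum]
      refine Finset.sum_le_sum fun t _ => ?_
      have : (N : ℂ) * (E t - Y t) = -∑ k, (E (sw k t) - Y (sw k t)) := by
        rw [Finset.sum_sub_distrib]
        linear_combination -hYeq t
      calc (N : ℝ) * ‖E t - Y t‖ = ‖(N : ℂ) * (E t - Y t)‖ := by simp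
        _ = ‖∑ k, (E (sw k t) - Y (sw k t))‖ := by rw [this, norm_neg]
        _ ≤ _ := norm_sum_le _ _
    have hnn : 0 ≤ ∑ t, ‖E t - Y t‖ := Finset.sum_nonneg fun t _ => norm_nonneg _
    nlinarith
  have := (Finset.sum_eq_zero_iff_of_nonneg fun t _ => norm_nonneg (E t - Y t)).1 hzero t
    (Finset.mem_univ t)
  rw [sub_eq_zero.1 (norm_eq_zero.1 this)]
  exact hY t

end Neumann

/-! ## Monotone sequences of transpositions -/

/-- Sequences of transpositions `(a_t b_t)` with `a_t < b_t` and `b_t` nondecreasing. -/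
@[ext]
structure MonoSeq (S : Type) [LinearOrder S] (r : ℕ) : Type where
  /-- the pairs `(a_t, b_t)` -/
  seq : Fin r → S × S
  lt : ∀ t, (seq t).1 < (seq t).2
  mono : Monotone fun t => (seq t).2

namespace MonoSeq

variable {S S' : Type} [LinearOrder S] [LinearOrder S'] {r : ℕ}

instance [Finite S] : Finite (MonoSeq S r) :=
  Finite.of_injective MonoSeq.seq fun _ _ h => MonoSeq.ext h

instance [Finite S] : Fintype (MonoSeq S r) := Fintype.ofFinite _

/-- The product `(a_0 b_0) (a_1 b_1) ⋯`. -/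
def perm (τ : MonoSeq S r) : Equiv.Perm S :=
  (List.ofFn fun t => Equiv.swap (τ.seq t).1 (τ.seq t).2).prod

/-- The image of a sequence under an order embedding. -/
def map (f : S ↪o S') (τ : MonoSeq S r) : MonoSeq S' r :=
  ⟨fun t => (f (τ.seq t).1, f (τ.seq t).2), fun t => f.lt_iff_lt.2 (τ.lt t),
    fun _ _ h => f.monotone (τ.mono h)⟩

theorem prod_swap_map_apply (f : S ↪o S') (L : List (S × S)) (s : S) :
    (L.map fun x => Equiv.swap (f x.1) (f x.2)).prod (f s) =
      f ((L.map fun x => Equiv.swap x.1 x.2).prod s) := by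
  induction L with
  | nil => simp
  | cons x L ih =>
    rw [List.map_cons, List.map_cons, List.prod_cons, List.prod_cons, Equiv.Perm.mul_apply,
      Equiv.Perm.mul_apply, ih]
    exact (f.injective.map_swap _ _ _).symm

theorem prod_swap_map_apply_of_forall_ne (f : S ↪o S') (L : List (S × S)) (u : S')
    (hu : ∀ s, u ≠ f s) : (L.map fun x => Equiv.swap (f x.1) (f x.2)).prod u = u := by
  induction L with
  | nil => simp
  | cons x L ih =>
    rw [List.map_cons, List.prod_cons, Equiv.Perm.mul_apply, ih,
      Equiv.swap_apply_of_ne_of_ne (hu _) (hu _)]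

theorem perm_eq_list (τ : MonoSeq S r) :
    τ.perm = ((List.ofFn τ.seq).map fun x => Equiv.swap x.1 x.2).prod := by
  rw [List.map_ofFn]
  rfl

theorem perm_map_eq_list (f : S ↪o S') (τ : MonoSeq S r) :
    (τ.map f).perm = ((List.ofFn τ.seq).map fun x => Equiv.swap (f x.1) (f x.2)).prod := by
  rw [List.map_ofFn]
  rfl

theorem perm_map_apply (f : S ↪o S') (τ : MonoSeq S r) (s : S) :
    (τ.map f).perm (f s) = f (τ.perm s) := by
  rw [perm_map_eq_list, perm_eq_list, prod_swap_map_apply]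

theorem perm_map_inv_apply (f : S ↪o S') (τ : MonoSeq S r) (s : S) :
    (τ.map f).perm⁻¹ (f s) = f (τ.perm⁻¹ s) := by
  rw [Equiv.Perm.inv_eq_iff_eq, perm_map_apply, ← Equiv.Perm.mul_apply, mul_inv_cancel, Equiv.Perm.one_apply]

theorem perm_map_inv_apply_of_forall_ne (f : S ↪o S') (τ : MonoSeq S r) (u : S')
    (hu : ∀ s, u ≠ f s) : (τ.map f).perm⁻¹ u = u := by
  rw [Equiv.Perm.inv_eq_iff_eq, perm_map_eq_list, prod_swap_map_apply_of_forall_ne f _ u hu]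

/-- Adding a transposition `(k, last)` at the end. -/
def snocLast {m : ℕ} (τ : MonoSeq (Fin (m + 1)) r) (k : Fin m) : MonoSeq (Fin (m + 1)) (r + 1) :=
  ⟨Fin.snoc (α := fun _ => Fin (m + 1) × Fin (m + 1)) τ.seq (k.castSucc, Fin.last m),
    fun t => by
      refine Fin.lastCases ?_ (fun t => ?_) t
      · simp [Fin.castSucc_lt_last]
      · simpa using τ.lt t,
    fun t u h => by
      induction u using Fin.lastCases with
      | last => simp [Fin.le_last]
      | cast u =>
        induction t using Fin.lastCases with
        | last => exact absurd h (not_le.2 (Fin.castSucc_lt_last u))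
        | cast t => simpa using τ.mono (Fin.castSucc_le_castSucc_iff.1 h)⟩

theorem perm_snocLast {m : ℕ} (τ : MonoSeq (Fin (m + 1)) r) (k : Fin m) :
    (τ.snocLast k).perm = τ.perm * Equiv.swap k.castSucc (Fin.last m) := by
  unfold perm
  rw [List.ofFn_succ', List.concat_eq_append, List.prod_append, List.prod_singleton]
  simp [snocLast]

/-- Since the `b_t` are nondecreasing, the maximum occurs in the sequence only if the last
transposition contains it. Either that transposition can be removed, leaving an arbitrary monotone
sequence, or the sequence lives on `Fin m`. The two cases match the exchange terms and the
contraction terms of `entryMoment_recursion`. -/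
theorem sumElim_bijective (m r : ℕ) : Function.Bijective
    (Sum.elim (fun x : Fin m × MonoSeq (Fin (m + 1)) r => x.2.snocLast x.1)
      (fun τ : MonoSeq (Fin m) (r + 1) => τ.map Fin.castSuccOrderEmb)) := by
  have hne : ∀ (k : Fin m) (τ : MonoSeq (Fin (m + 1)) r) (τ' : MonoSeq (Fin m) (r + 1)),
      τ.snocLast k ≠ τ'.map Fin.castSuccOrderEmb := fun k τ τ' h => by
    have h' : (Fin.snoc (α := fun _ => Fin (m + 1) × Fin (m + 1)) τ.seq (k.castSucc, Fin.last m)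
      (Fin.last r)).2 = (τ'.seq (Fin.last r)).2.castSucc :=
      congrArg (fun x => (x.seq (Fin.last r)).2) h
    rw [Fin.snoc_last] at h'
    exact (Fin.castSucc_lt_last _).ne h'.symm
  constructor
  · rintro (⟨k, τ⟩ | τ) (⟨k', τ'⟩ | τ') h
    · have h' : Fin.snoc (α := fun _ => Fin (m + 1) × Fin (m + 1)) τ.seq (k.castSucc, Fin.last m) =
        Fin.snoc (α := fun _ => Fin (m + 1) × Fin (m + 1)) τ'.seq (k'.castSucc, Fin.last m) :=
        congrArg MonoSeq.seq h
      have h2 := congrFun h' (Fin.last r)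
      have h3 := congrArg (fun f => Fin.init (α := fun _ => Fin (m + 1) × Fin (m + 1)) f) h'
      simp only [Fin.snoc_last, Prod.mk.injEq, Fin.init_snoc] at h2 h3
      obtain rfl := Fin.castSucc_injective _ h2.1
      obtain rfl := MonoSeq.ext h3
      rfl
    · exact absurd h (hne k τ τ')
    · exact absurd h.symm (hne k' τ' τ)
    · congr 1
      refine MonoSeq.ext (funext fun t => ?_)
      have h' : ((τ.seq t).1.castSucc, (τ.seq t).2.castSucc) =
        ((τ'.seq t).1.castSucc, (τ'.seq t).2.castSucc) := congrFun (congrArg MonoSeq.seq h) t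
      rw [Prod.mk.injEq] at h'
      exact Prod.ext (Fin.castSucc_injective _ h'.1) (Fin.castSucc_injective _ h'.2)
  · intro τ
    by_cases hlast : (τ.seq (Fin.last r)).2 = Fin.last m
    · have hlt : (τ.seq (Fin.last r)).1 < Fin.last m := hlast ▸ τ.lt (Fin.last r)
      refine ⟨Sum.inl ⟨(τ.seq (Fin.last r)).1.castPred hlt.ne,
        ⟨Fin.init (α := fun _ => Fin (m + 1) × Fin (m + 1)) τ.seq, fun t => τ.lt t.castSucc,
          fun t u h => τ.mono (Fin.castSucc_le_castSucc_iff.2 h)⟩⟩, MonoSeq.ext ?_⟩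
      change Fin.snoc (α := fun _ => Fin (m + 1) × Fin (m + 1)) (Fin.init τ.seq)
        (((τ.seq (Fin.last r)).1.castPred hlt.ne).castSucc, Fin.last m) = τ.seq
      rw [Fin.castSucc_castPred, ← hlast]
      exact Fin.snoc_init_self (α := fun _ => Fin (m + 1) × Fin (m + 1)) τ.seq
    · have h2 : ∀ t, (τ.seq t).2 ≠ Fin.last m := fun t ht =>
        hlast (le_antisymm (Fin.le_last _) (ht ▸ τ.mono (Fin.le_last t)))
      have h1 : ∀ t, (τ.seq t).1 ≠ Fin.last m := fun t ht =>
        absurd (τ.lt t) (not_lt.2 (ht ▸ Fin.le_last _))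
      refine ⟨Sum.inr ⟨fun t => ((τ.seq t).1.castPred (h1 t), (τ.seq t).2.castPred (h2 t)),
        fun t => (Fin.castPred_lt_castPred_iff (hi := h1 t) (hj := h2 t)).2 (τ.lt t),
        fun t u h => (Fin.castPred_le_castPred_iff (hi := h2 t) (hj := h2 u)).2 (τ.mono h)⟩,
        MonoSeq.ext (funext fun t => ?_)⟩
      simp [map]

end MonoSeq

/-! ## The expansion of the moments of entries -/

section Expansion

variable {N : ℕ}

/-- The number of bijections `π` with `i ∘ σ⁻¹ = i' ∘ π` and `j = j' ∘ π`. -/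
def matchCount {S S' : Type} [Fintype S] [Fintype S'] [DecidableEq S] [DecidableEq S'] (σ : Equiv.Perm S) (i j : S → Fin N)
    (i' j' : S' → Fin N) : ℂ :=
  ∑ π : S ≃ S', if ∀ s, i (σ⁻¹ s) = i' (π s) ∧ j s = j' (π s) then 1 else 0

/-- A permutation of `Fin (m + 1)` from the image of the last element and a permutation of the
others. -/
def permOfLast {m : ℕ} (x : Fin (m + 1) × Equiv.Perm (Fin m)) : Equiv.Perm (Fin (m + 1)) :=
  (finSuccEquivLast.trans (Equiv.optionCongr x.2)).trans (finSuccEquiv' x.1).symm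

theorem permOfLast_last {m : ℕ} (x : Fin (m + 1) × Equiv.Perm (Fin m)) :
    permOfLast x (Fin.last m) = x.1 := by
  simp [permOfLast]

theorem permOfLast_castSucc {m : ℕ} (x : Fin (m + 1) × Equiv.Perm (Fin m)) (s : Fin m) :
    permOfLast x s.castSucc = x.1.succAbove (x.2 s) := by
  simp [permOfLast]

theorem permOfLast_bijective (m : ℕ) : Function.Bijective (permOfLast (m := m)) := by
  rw [Fintype.bijective_iff_injective_and_card]
  constructor
  · rintro ⟨k, π⟩ ⟨k', π'⟩ h
    obtain rfl : k = k' := by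
      simpa only [permOfLast_last] using congrArg (fun e => e (Fin.last m)) h
    congr 1
    ext s : 1
    have := congrArg (fun e => e s.castSucc) h
    simp only [permOfLast_castSucc] at this
    exact Fin.succAbove_right_injective this
  · simp [Fintype.card_perm, Nat.factorial_succ]

/-- The permutation fixes the last element, so the condition there only involves `k = π (last)` and
gives the two equalities; the other conditions form the smaller problem for the rest of `π`. -/
theorem matchCount_perm_map {m r : ℕ} (τ : MonoSeq (Fin m) r) (i j i' j' : Fin (m + 1) → Fin N) :
    matchCount (τ.map Fin.castSuccOrderEmb).perm i j i' j' =
      ∑ k, if i (Fin.last m) = i' k ∧ j (Fin.last m) = j' k then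
        matchCount τ.perm (i ∘ Fin.castSucc) (j ∘ Fin.castSucc) (i' ∘ k.succAbove)
          (j' ∘ k.succAbove) else 0 := by
  unfold matchCount
  refine ((permOfLast_bijective m).sum_comp _).symm.trans ?_
  rw [Fintype.sum_prod_type]
  refine Finset.sum_congr rfl fun k _ => ?_
  have hl : (τ.map Fin.castSuccOrderEmb).perm⁻¹ (Fin.last m) = Fin.last m :=
    τ.perm_map_inv_apply_of_forall_ne _ _ fun s => (Fin.castSucc_lt_last s).ne'
  have hc : ∀ s, (τ.map Fin.castSuccOrderEmb).perm⁻¹ (Fin.castSucc s) =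
      Fin.castSucc (τ.perm⁻¹ s) := fun s => τ.perm_map_inv_apply Fin.castSuccOrderEmb s
  simp only [Fin.forall_fin_succ', permOfLast_last, permOfLast_castSucc, hl, hc,
    Function.comp_apply]
  by_cases h : i (Fin.last m) = i' k ∧ j (Fin.last m) = j' k
  · simp only [h.1, h.2, and_self, and_true, if_true]
    exact Finset.sum_congr rfl fun π _ => by congr
  · simp [h]

/-- Inversion moves the swap to the left of `σ⁻¹`, next to `i`: a transposition appended to the
sequence becomes an exchange of row indices. -/
theorem matchCount_mul_swap {S S' : Type} [Fintype S] [Fintype S'] [DecidableEq S] [DecidableEq S']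
    (σ : Equiv.Perm S) (a b : S)
    (i j : S → Fin N) (i' j' : S' → Fin N) :
    matchCount (σ * Equiv.swap a b) i j i' j' = matchCount σ (i ∘ Equiv.swap a b) j i' j' := by
  simp [matchCount, mul_inv_rev, Equiv.swap_inv]

/-- The sum of `matchCount` over the monotone sequences of length `r`. -/
def monotoneCount {S S' : Type} [Fintype S] [LinearOrder S] [Fintype S'] [DecidableEq S'] (r : ℕ) (i j : S → Fin N)
    (i' j' : S' → Fin N) : ℂ :=
  ∑ τ : MonoSeq S r, matchCount τ.perm i j i' j'

theorem monotoneCount_zero {S S' : Type} [Fintype S] [LinearOrder S] [Fintype S'] [DecidableEq S']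
    (i j : S → Fin N) (i' j' : S' → Fin N) :
    monotoneCount 0 i j i' j' = matchCount 1 i j i' j' := by
  let τ₀ : MonoSeq S 0 := ⟨Fin.elim0, fun t => t.elim0, fun t => t.elim0⟩
  have huniq : ∀ τ : MonoSeq S 0, τ = τ₀ := fun τ => MonoSeq.ext (funext fun t => t.elim0)
  unfold monotoneCount
  rw [Fintype.sum_eq_single τ₀ fun τ h => absurd (huniq τ) h]
  rfl

theorem monotoneCount_zero_succ {m : ℕ} (i j i' j' : Fin (m + 1) → Fin N) :
    monotoneCount 0 i j i' j' =
      ∑ k, if i (Fin.last m) = i' k ∧ j (Fin.last m) = j' k then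
        monotoneCount 0 (i ∘ Fin.castSucc) (j ∘ Fin.castSucc) (i' ∘ k.succAbove)
          (j' ∘ k.succAbove) else 0 := by
  simp_rw [monotoneCount_zero]
  exact matchCount_perm_map (⟨Fin.elim0, fun t => t.elim0, fun t => t.elim0⟩ : MonoSeq (Fin m) 0)
    i j i' j'

/-- With the signs and powers of `N` of `expansionTerm`, this is `entryMoment_recursion` graded by
`r`. -/
theorem monotoneCount_succ_succ {m r : ℕ} (i j i' j' : Fin (m + 1) → Fin N) :
    monotoneCount (r + 1) i j i' j' =
      ∑ k : Fin m, monotoneCount r (i ∘ Equiv.swap k.castSucc (Fin.last m)) j i' j' +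
      ∑ k, if i (Fin.last m) = i' k ∧ j (Fin.last m) = j' k then
        monotoneCount (r + 1) (i ∘ Fin.castSucc) (j ∘ Fin.castSucc) (i' ∘ k.succAbove)
          (j' ∘ k.succAbove) else 0 := by
  unfold monotoneCount
  rw [← (MonoSeq.sumElim_bijective m r).sum_comp, Fintype.sum_sum_type, Fintype.sum_prod_type]
  simp only [Sum.elim_inl, Sum.elim_inr, MonoSeq.perm_snocLast, matchCount_mul_swap,
    matchCount_perm_map]
  congr 1
  rw [Finset.sum_comm]
  refine Finset.sum_congr rfl fun k _ => ?_
  split_ifs <;> simp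

/-- The terms of the expansion of a moment of entries. -/
def expansionTerm {S S' : Type} [Fintype S] [LinearOrder S] [Fintype S'] [DecidableEq S'] (r : ℕ)
    (i j : S → Fin N) (i' j' : S' → Fin N) : ℂ :=
  (-1) ^ r / (N : ℂ) ^ (r + Fintype.card S) * monotoneCount r i j i' j'

/-- Induction on the degree: at degree `m + 1` there are `m` exchange terms, and `m + 1 ≤ N` is
exactly the condition `m < N` for the Neumann series. -/
theorem hasSum_expansionTerm_fin (hN : 1 ≤ N) {m : ℕ} (hm : m ≤ N) (i j i' j' : Fin m → Fin N) :
    Summable (fun r => ‖expansionTerm r i j i' j'‖) ∧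
      HasSum (fun r => expansionTerm r i j i' j') (entryMoment i j i' j') := by
  have hN0 : (N : ℂ) ≠ 0 := by exact_mod_cast (by omega : N ≠ 0)
  induction m with
  | zero =>
    have h0 : expansionTerm 0 i j i' j' = 1 := by
      simp [expansionTerm, monotoneCount_zero, matchCount]
    have h1 : ∀ r, r ≠ 0 → expansionTerm r i j i' j' = 0 := fun r hr => by
      have : IsEmpty (MonoSeq (Fin 0) r) := ⟨fun τ => (τ.seq ⟨0, Nat.pos_of_ne_zero hr⟩).1.elim0⟩
      simp [expansionTerm, monotoneCount]
    have hE : entryMoment i j i' j' = 1 := by simp [entryMoment, entryProd]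
    refine ⟨summable_of_ne_finset_zero (s := {0}) fun r hr => ?_, ?_⟩
    · rw [h1 r (by simpa using hr), norm_zero]
    · rw [hE, ← h0]
      exact hasSum_single 0 h1
  | succ m ih =>
    -- The exchanges act on `i` alone, so the recursion takes place on the finite set of functions
    -- `i`, with `j`, `i'`, `j'` fixed.
    let sw : Fin m → Equiv.Perm (Fin (m + 1) → Fin N) := fun k =>
      (Equiv.swap k.castSucc (Fin.last m)).arrowCongr (Equiv.refl _)
    have hsw : ∀ k i, sw k i = i ∘ Equiv.swap k.castSucc (Fin.last m) := fun k i => by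
      funext s
      simp [sw, Equiv.arrowCongr]
    let R : ℕ → (Fin (m + 1) → Fin N) → ℂ := fun r i =>
      ∑ k, if i (Fin.last m) = i' k ∧ j (Fin.last m) = j' k then
        expansionTerm r (i ∘ Fin.castSucc) (j ∘ Fin.castSucc) (i' ∘ k.succAbove)
          (j' ∘ k.succAbove) else 0
    have hRterm : ∀ r i (c : ℂ), c * (∑ k, if i (Fin.last m) = i' k ∧ j (Fin.last m) = j' k then
        monotoneCount r (i ∘ Fin.castSucc) (j ∘ Fin.castSucc) (i' ∘ k.succAbove)
          (j' ∘ k.succAbove) else 0) = ∑ k, if i (Fin.last m) = i' k ∧ j (Fin.last m) = j' k then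
        c * monotoneCount r (i ∘ Fin.castSucc) (j ∘ Fin.castSucc) (i' ∘ k.succAbove)
          (j' ∘ k.succAbove) else 0 := fun r i c => by
      rw [Finset.mul_sum]
      exact Finset.sum_congr rfl fun k _ => by rw [mul_ite, mul_zero]
    have hRsum : ∀ i, Summable fun r => ‖R r i‖ := by
      intro i
      refine Summable.of_nonneg_of_le (fun r => norm_nonneg _) (fun r => norm_sum_le _ _) ?_
      refine summable_sum fun k _ => ?_
      split_ifs
      · exact (ih (by omega) _ _ _ _).1
      · simp
    refine hasSum_of_neumann_recursion (m := m) (N := N) (by omega) sw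
      (fun r i => expansionTerm r i j i' j') R (fun i => entryMoment i j i' j') ?_ ?_ hRsum ?_ i
    · intro i
      simp only [expansionTerm, R, Fintype.card_fin, monotoneCount_zero_succ i, hRterm]
      rw [Finset.mul_sum]
      refine Finset.sum_congr rfl fun k _ => ?_
      split_ifs
      · field_simp
        ring
      · simp
    · intro r i
      simp only [expansionTerm, R, Fintype.card_fin, monotoneCount_succ_succ i, hsw, mul_add,
        hRterm]
      rw [← Finset.mul_sum, add_right_comm]
      have : (N : ℂ) * ((-1) ^ (r + 1) / (N : ℂ) ^ (r + 1 + (m + 1)) *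
          ∑ k : Fin m, monotoneCount r (i ∘ Equiv.swap k.castSucc (Fin.last m)) j i' j') +
          (-1) ^ r / (N : ℂ) ^ (r + (m + 1)) *
          ∑ k : Fin m, monotoneCount r (i ∘ Equiv.swap k.castSucc (Fin.last m)) j i' j' = 0 := by
        field_simp
        ring
      rw [this, zero_add, Finset.mul_sum]
      refine Finset.sum_congr rfl fun k _ => ?_
      split_ifs
      · field_simp
        ring
      · simp
    · intro i
      simp only [hsw]
      rw [entryMoment_recursion]
      refine hasSum_sum fun k _ => ?_
      split_ifs
      · exact (ih (by omega) _ _ _ _).2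
      · exact hasSum_zero

/-- Monotone sequences use the order of the first index set, which must be respected; the second one
only enters through bijections. -/
theorem monotoneCount_comp_equiv {S S' T T' : Type} [Fintype S] [LinearOrder S] [Fintype S']
    [DecidableEq S'] [Fintype T] [LinearOrder T] [Fintype T'] [DecidableEq T'] (e : T ≃o S)
    (e' : T' ≃ S') (r : ℕ) (i j : S → Fin N) (i' j' : S' → Fin N) :
    monotoneCount r (i ∘ e) (j ∘ e) (i' ∘ e') (j' ∘ e') = monotoneCount r i j i' j' := by
  have hbij : Function.Bijective (MonoSeq.map (r := r) e.toOrderEmbedding) := by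
    constructor
    · intro τ τ' h
      refine MonoSeq.ext (funext fun t => ?_)
      have h' : (e (τ.seq t).1, e (τ.seq t).2) = (e (τ'.seq t).1, e (τ'.seq t).2) :=
        congrFun (congrArg MonoSeq.seq h) t
      rw [Prod.mk.injEq] at h'
      exact Prod.ext (e.injective h'.1) (e.injective h'.2)
    · intro τ
      refine ⟨τ.map e.symm.toOrderEmbedding, MonoSeq.ext (funext fun t => ?_)⟩
      simp [MonoSeq.map]
  unfold monotoneCount
  refine Eq.trans (Finset.sum_congr rfl fun τ _ => ?_) (hbij.sum_comp _)
  unfold matchCount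
  refine Eq.trans (Finset.sum_congr rfl fun π _ => ?_)
    ((Equiv.equivCongr e.toEquiv e').sum_comp _)
  refine if_congr ?_ rfl rfl
  rw [e.surjective.forall]
  refine forall_congr' fun s => ?_
  rw [show (τ.map e.toOrderEmbedding).perm⁻¹ (e s) = e (τ.perm⁻¹ s) from
    τ.perm_map_inv_apply e.toOrderEmbedding s]
  simp [Equiv.equivCongr]

/-- The expansion of the moments of entries of a Haar unitary matrix. -/
theorem hasSum_expansionTerm (hN : 1 ≤ N) {S S' : Type} [Fintype S] [LinearOrder S] [Fintype S']
    [DecidableEq S'] (hcard : Fintype.card S = Fintype.card S') (hS : Fintype.card S ≤ N)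
    (i j : S → Fin N) (i' j' : S' → Fin N) :
    Summable (fun r => ‖expansionTerm r i j i' j'‖) ∧
      HasSum (fun r => expansionTerm r i j i' j') (entryMoment i j i' j') := by
  let e : Fin (Fintype.card S) ≃o S := Fintype.orderIsoFinOfCardEq S rfl
  let e' : Fin (Fintype.card S) ≃ S' := (Fintype.equivFinOfCardEq hcard.symm).symm
  have h1 : ∀ r, expansionTerm r (i ∘ e) (j ∘ e) (i' ∘ e') (j' ∘ e') =
      expansionTerm r i j i' j' := fun r => by
    unfold expansionTerm
    rw [monotoneCount_comp_equiv, Fintype.card_fin]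
  have h2 : entryMoment (i ∘ e) (j ∘ e) (i' ∘ e') (j' ∘ e') = entryMoment i j i' j' := by
    unfold entryMoment
    congr 1
    funext U
    unfold entryProd
    congr 1
    · exact e.toEquiv.prod_comp fun s => (U : Matrix (Fin N) (Fin N) ℂ) (i s) (j s)
    · exact e'.prod_comp fun s => (U : Matrix (Fin N) (Fin N) ℂ).conjTranspose (j' s) (i' s)
  have := hasSum_expansionTerm_fin hN hS (i ∘ e) (j ∘ e) (i' ∘ e') (j' ∘ e')
  simp_rw [h1, h2] at this
  exact this

end Expansion

/-! ## Black vertices and faces -/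

namespace UnitaryMap

variable {I : Type} {r : ℕ} (C : UnitaryMap I r)

theorem vertex_eq_iff {h h' : C.HalfEdge} :
    C.vertex h = C.vertex h' ↔ C.next.SameCycle h h' :=
  Quotient.eq (r := Equiv.Perm.SameCycle.setoid C.next)

theorem minimalPeriod_next {h : C.HalfEdge} (hb : C.IsBlack (C.vertex h)) :
    Function.minimalPeriod C.next h = 4 := by
  have hcard := C.degree_black _ hb
  have hper : h ∈ Function.periodicPts C.next :=
    Function.Injective.mem_periodicPts C.next.injective h
  have hpos := Function.minimalPeriod_pos_of_mem_periodicPts hper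
  let f : Fin (Function.minimalPeriod C.next h) → {h' // C.vertex h' = C.vertex h} := fun k =>
    ⟨(C.next ^ (k : ℕ)) h, C.vertex_eq_iff.2 (Equiv.Perm.SameCycle.symm ⟨(k : ℕ), by simp⟩)⟩
  have hf : Function.Bijective f := by
    constructor
    · intro k k' hk
      have hk' := congrArg Subtype.val hk
      simp only [f, Equiv.Perm.coe_pow] at hk'
      exact Fin.ext (Function.iterate_injOn_Iio_minimalPeriod k.2 k'.2 hk')
    · rintro ⟨h', hh'⟩
      obtain ⟨n, -, hn⟩ := (C.vertex_eq_iff.1 hh').symm.exists_pow_eq'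
      refine ⟨⟨n % _, Nat.mod_lt _ hpos⟩, Subtype.ext ?_⟩
      simp only [f, Equiv.Perm.coe_pow] at hn ⊢
      rw [← hn]
      exact Function.iterate_mod_minimalPeriod_eq
  rw [← Nat.card_eq_of_bijective f hf, Nat.card_fin] at hcard
  exact hcard

theorem next_four {h : C.HalfEdge} (hb : C.IsBlack (C.vertex h)) :
    C.next (C.next (C.next (C.next h))) = h := by
  have := Function.isPeriodicPt_minimalPeriod C.next h
  rwa [C.minimalPeriod_next hb] at this

theorem next_two_ne {h : C.HalfEdge} (hb : C.IsBlack (C.vertex h)) : C.next (C.next h) ≠ h := by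
  intro hc
  have : Function.IsPeriodicPt C.next 2 h := hc
  have := Nat.le_of_dvd (by norm_num) this.minimalPeriod_dvd
  rw [C.minimalPeriod_next hb] at this
  omega

theorem eq_of_vertex_eq {h h' : C.HalfEdge} (hb : C.IsBlack (C.vertex h))
    (hh : C.vertex h' = C.vertex h) :
    h' = h ∨ h' = C.next h ∨ h' = C.next (C.next h) ∨ h' = C.next (C.next (C.next h)) := by
  obtain ⟨n, -, hn⟩ := (C.vertex_eq_iff.1 hh).symm.exists_pow_eq'
  rw [Equiv.Perm.coe_pow, ← Function.iterate_mod_minimalPeriod_eq, C.minimalPeriod_next hb] at hn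
  have h4 : n % 4 < 4 := Nat.mod_lt _ (by norm_num)
  generalize n % 4 = k at hn h4
  subst hn
  interval_cases k <;> simp

theorem isBlack_black (k : Fin r) : C.IsBlack (C.black k) := (C.black k).2

theorem isBlack_of_eq {h : C.HalfEdge} {k : Fin r} (hk : C.vertex h = C.black k) :
    C.IsBlack (C.vertex h) := hk ▸ C.isBlack_black k

theorem exists_black {h : C.HalfEdge} (hb : C.IsBlack (C.vertex h)) :
    ∃ k, C.vertex h = C.black k := ⟨C.black.symm ⟨_, hb⟩, by simp⟩

theorem exists_white_or_black (h : C.HalfEdge) :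
    (∃ i, h = C.white i) ∨ ∃ k, C.vertex h = C.black k := by
  by_cases hw : C.IsWhite h
  · exact Or.inl ⟨C.white.symm ⟨h, hw⟩, by simp⟩
  · exact Or.inr (C.exists_black (not_not.1 hw))

theorem black_injective {k l : Fin r} (h : (C.black k : C.Vertex) = C.black l) : k = l :=
  C.black.injective (Subtype.ext h)

/-- Crossing an edge reverses the sign, and one step around a black vertex reverses it again, so
turning left at black vertices follows the orientation. -/
theorem sign_face {h : C.HalfEdge} (hb : C.IsBlack (C.vertex (C.face h))) :
    C.sign (C.face h) = C.sign h := by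
  have := C.alternated_black _ hb
  rw [C.next_face, C.sign_opp, neg_inj] at this
  exact this.symm

theorem isWhite_white (i : I) : C.IsWhite (C.white i) := (C.white i).2

theorem next_white (i : I) : C.next (C.white i) = C.white (C.rho i) := by
  simp only [rho, Equiv.trans_apply, Equiv.apply_symm_apply]
  rfl

theorem face_eq_white {h : C.HalfEdge} {i : I} (hi : C.opp h = C.white i) :
    C.face h = C.white (C.rho⁻¹ i) := by
  apply C.next.injective
  rw [C.next_face, C.next_white, hi]
  simp

theorem labelOf_eq {h : C.HalfEdge} {i : I} {k : ℕ} (hk : (C.face⁻¹ ^ k) h = C.white i)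
    (hmin : ∀ j < k, ¬ C.IsWhite ((C.face⁻¹ ^ j) h)) : C.labelOf h = i := by
  classical
  unfold labelOf
  rw [Equiv.symm_apply_eq]
  apply Subtype.ext
  have : Nat.find (C.exists_white_face_inv h) = k := by
    rw [Nat.find_eq_iff]
    exact ⟨by rw [hk]; exact C.isWhite_white i, hmin⟩
  rw [← hk, ← this]

theorem labelOf_white (i : I) : C.labelOf (C.white i) = i :=
  C.labelOf_eq (k := 0) (by simp) fun _ h => absurd h (Nat.not_lt_zero _)

/-- The backward walk from a nonwhite `C.face h` passes through `h`, so labels are constant along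
strands. -/
theorem labelOf_face {h : C.HalfEdge} (hb : C.IsBlack (C.vertex (C.face h))) :
    C.labelOf (C.face h) = C.labelOf h := by
  classical
  have hp : ∀ k, (C.face⁻¹ ^ (k + 1)) (C.face h) = (C.face⁻¹ ^ k) h := fun k => by
    rw [pow_succ, Equiv.Perm.mul_apply]
    simp
  refine C.labelOf_eq (k := Nat.find (C.exists_white_face_inv h) + 1) ?_ ?_
  · rw [hp]
    unfold labelOf
    rw [Equiv.apply_symm_apply]
  · intro j hj
    cases j with
    | zero => simpa [IsWhite] using hb
    | succ j =>
      rw [hp]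
      exact Nat.find_min (C.exists_white_face_inv h) (by omega)

/-- The first white half-edge after `h` around the face has the label `j`. -/
def Reaches (h : C.HalfEdge) (j : I) : Prop :=
  ∃ k : ℕ, 0 < k ∧ (C.face ^ k) h = C.white j ∧
    ∀ l, 0 < l → l < k → ¬ C.IsWhite ((C.face ^ l) h)

variable {C}

theorem Reaches.of_face_eq {h : C.HalfEdge} {j : I} (hj : C.face h = C.white j) :
    C.Reaches h j :=
  ⟨1, one_pos, by simpa using hj, fun _ h1 h2 => absurd h2 (by omega)⟩

/-- Lets `φ` be computed by induction along a face, without naming the first return time. -/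
theorem Reaches.of_face {h : C.HalfEdge} {j : I} (hb : C.IsBlack (C.vertex (C.face h)))
    (hj : C.Reaches (C.face h) j) : C.Reaches h j := by
  obtain ⟨k, hk, hkj, hmin⟩ := hj
  have hp : ∀ k, (C.face ^ (k + 1)) h = (C.face ^ k) (C.face h) := fun k => by
    rw [pow_succ, Equiv.Perm.mul_apply]
  refine ⟨k + 1, by omega, by rw [hp, hkj], fun l hl hlk => ?_⟩
  obtain ⟨l, rfl⟩ : ∃ n, l = n + 1 := ⟨l - 1, by omega⟩
  rw [hp]
  rcases Nat.eq_zero_or_pos l with rfl | hl'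
  · simpa [IsWhite] using hb
  · exact hmin l hl' (by omega)

theorem Reaches.phi_eq {i j : I} (h : C.Reaches (C.white i) j) : C.phi i = j := by
  obtain ⟨k, hk, hkj, hmin⟩ := h
  have h1 : firstReturnFun C.face C.IsWhite (C.white i) = C.white j :=
    firstReturnFun_eq C.face C.IsWhite _ _ hk hkj hmin
  have h2 : C.phi i = C.white.symm (firstReturnFun C.face C.IsWhite (C.white i)) := rfl
  rw [h2, h1, Equiv.symm_apply_apply]

end UnitaryMap

/-! ## Sweeping a map of unitary type -/

/-- The labels of the outgoing white half-edges. -/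
abbrev OutLabel {I : Type} (ε : I → ℤˣ) : Type := {i // ε i = 1}

/-- The labels of the ingoing white half-edges. -/
abbrev InLabel {I : Type} (ε : I → ℤˣ) : Type := {i // ε i = -1}

/-- The black vertices of `C` are swept in the order of their numbers by the strands that start at
the outgoing white half-edges and turn left at each vertex: `pos t s` is the last outgoing half-edge
of the strand `s` that comes before the black vertex number `t`. The vertex number `t` is visited by
the two strands `τ t`, and the strand `s` ends at the ingoing white half-edge labelled `π s`. -/
structure Sweep {I : Type} {r : ℕ} {ε : I → ℤˣ} (C : UnitaryMap I r)
    (τ : Fin r → OutLabel ε × OutLabel ε) (π : OutLabel ε ≃ InLabel ε) : Type where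
  eps_eq : C.eps = ε
  pos : ℕ → OutLabel ε → C.HalfEdge
  pos_zero : ∀ s, pos 0 s = C.white s
  pos_succ_of_ne : ∀ (t : Fin r) s, s ≠ (τ t).1 → s ≠ (τ t).2 → pos (t + 1) s = pos t s
  pos_succ_fst : ∀ t : Fin r, pos (t + 1) (τ t).1 = C.face (pos t (τ t).1)
  pos_succ_snd : ∀ t : Fin r, pos (t + 1) (τ t).2 = C.face (pos t (τ t).2)
  vertex_fst : ∀ t : Fin r, C.vertex (pos (t + 1) (τ t).1) = C.black t
  next_next_fst : ∀ t : Fin r, C.next (C.next (pos (t + 1) (τ t).1)) = pos (t + 1) (τ t).2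
  opp_last : ∀ s, C.opp (pos r s) = C.white (π s)

namespace Sweep

variable {I : Type} {r : ℕ} {ε : I → ℤˣ} {C : UnitaryMap I r}
  {τ : Fin r → OutLabel ε × OutLabel ε} {π : OutLabel ε ≃ InLabel ε} (W : Sweep C τ π)

/-- The strand `s` visits the black vertex number `t`. -/
def Hits (τ : Fin r → OutLabel ε × OutLabel ε) (t : Fin r) (s : OutLabel ε) : Prop :=
  s = (τ t).1 ∨ s = (τ t).2

/-! ### Positions of the strands and their coincidences -/

theorem vertex_snd (t : Fin r) : C.vertex (W.pos (t + 1) (τ t).2) = C.black t := by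
  rw [← W.next_next_fst, C.vertex_next, C.vertex_next, W.vertex_fst]

theorem next_next_snd (t : Fin r) :
    C.next (C.next (W.pos (t + 1) (τ t).2)) = W.pos (t + 1) (τ t).1 := by
  rw [← W.next_next_fst, C.next_four (C.isBlack_of_eq (W.vertex_fst t))]

theorem pos_succ_of_not_hits {t : Fin r} {s : OutLabel ε} (h : ¬ Hits τ t s) :
    W.pos (t + 1) s = W.pos t s :=
  W.pos_succ_of_ne t s (fun hc => h (Or.inl hc)) (fun hc => h (Or.inr hc))

theorem pos_succ_of_hits {t : Fin r} {s : OutLabel ε} (h : Hits τ t s) :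
    W.pos (t + 1) s = C.face (W.pos t s) := by
  rcases h with rfl | rfl
  exacts [W.pos_succ_fst t, W.pos_succ_snd t]

theorem vertex_of_hits {t : Fin r} {s : OutLabel ε} (h : Hits τ t s) :
    C.vertex (W.pos (t + 1) s) = C.black t := by
  rcases h with rfl | rfl
  exacts [W.vertex_fst t, W.vertex_snd t]

theorem vertex_opp_of_hits {t : Fin r} {s : OutLabel ε} (h : Hits τ t s) :
    C.vertex (C.opp (W.pos t s)) = C.black t := by
  rw [← C.vertex_face, ← W.pos_succ_of_hits h, W.vertex_of_hits h]

theorem next_of_hits {t : Fin r} {s : OutLabel ε} (h : Hits τ t s) :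
    C.next (W.pos (t + 1) s) = C.opp (W.pos t s) := by
  rw [W.pos_succ_of_hits h, C.next_face]

theorem sign_pos {t : ℕ} (ht : t ≤ r) (s : OutLabel ε) : C.sign (W.pos t s) = 1 := by
  induction t with
  | zero =>
    rw [W.pos_zero]
    exact (congrFun W.eps_eq s).trans s.2
  | succ t ih =>
    by_cases h : Hits τ ⟨t, ht⟩ s
    · have h1 := W.pos_succ_of_hits h
      have h2 := W.vertex_of_hits h
      simp only at h1 h2
      rw [h1] at h2
      rw [h1, C.sign_face (C.isBlack_of_eq h2), ih (by omega)]
    · have h1 := W.pos_succ_of_not_hits h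
      simp only at h1
      rw [h1, ih (by omega)]

theorem labelOf_pos {t : ℕ} (ht : t ≤ r) (s : OutLabel ε) : C.labelOf (W.pos t s) = s := by
  induction t with
  | zero => rw [W.pos_zero, C.labelOf_white]
  | succ t ih =>
    by_cases h : Hits τ ⟨t, ht⟩ s
    · have h1 := W.pos_succ_of_hits h
      have h2 := W.vertex_of_hits h
      simp only at h1 h2
      rw [h1] at h2
      rw [h1, C.labelOf_face (C.isBlack_of_eq h2), ih (by omega)]
    · have h1 := W.pos_succ_of_not_hits h
      simp only at h1
      rw [h1, ih (by omega)]

theorem eq_of_pos_eq {t t' : ℕ} (ht : t ≤ r) (ht' : t' ≤ r) {s s' : OutLabel ε}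
    (h : W.pos t s = W.pos t' s') : s = s' :=
  Subtype.ext (by rw [← W.labelOf_pos ht, h, W.labelOf_pos ht'])

/-- The two visiting strands account for all four half-edges: an outgoing and an ingoing one each.
-/
theorem exists_hits_of_vertex_eq {h : C.HalfEdge} {t : Fin r} (hh : C.vertex h = C.black t) :
    ∃ s, Hits τ t s ∧ (h = W.pos (t + 1) s ∨ h = C.opp (W.pos t s)) := by
  have hb := C.isBlack_of_eq (W.vertex_fst t)
  rcases C.eq_of_vertex_eq hb (hh.trans (W.vertex_fst t).symm) with h1 | h1 | h1 | h1
  · exact ⟨_, Or.inl rfl, Or.inl h1⟩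
  · exact ⟨_, Or.inl rfl, Or.inr (by rw [h1, W.next_of_hits (Or.inl rfl)])⟩
  · exact ⟨_, Or.inr rfl, Or.inl (by rw [h1, W.next_next_fst])⟩
  · exact ⟨_, Or.inr rfl, Or.inr (by rw [h1, W.next_next_fst, W.next_of_hits (Or.inr rfl)])⟩

theorem exists_hits_of_sign_eq_one {h : C.HalfEdge} {t : Fin r} (hh : C.vertex h = C.black t)
    (hs : C.sign h = 1) : ∃ s, Hits τ t s ∧ h = W.pos (t + 1) s := by
  obtain ⟨s, hts, rfl | rfl⟩ := W.exists_hits_of_vertex_eq hh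
  · exact ⟨s, hts, rfl⟩
  · rw [C.sign_opp, W.sign_pos (by omega)] at hs
    exact absurd hs (by decide)

/-- Expresses visits through positions alone, which is what allows `τ` to be recovered from the map.
-/
theorem hits_iff {t : Fin r} {s : OutLabel ε} :
    Hits τ t s ↔ C.vertex (C.opp (W.pos t s)) = C.black t := by
  refine ⟨W.vertex_opp_of_hits, fun h => ?_⟩
  obtain ⟨s', hs', h1 | h1⟩ := W.exists_hits_of_vertex_eq h
  · have h2 := congrArg C.sign h1
    rw [C.sign_opp, W.sign_pos (by omega), W.sign_pos (by omega)] at h2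
    exact absurd h2 (by decide)
  · obtain rfl := W.eq_of_pos_eq (by omega) (by omega) (C.opp.injective h1)
    exact hs'

theorem lt_of_vertex_pos {t : ℕ} (ht : t ≤ r) {s : OutLabel ε} {k : Fin r}
    (h : C.vertex (W.pos t s) = C.black k) : (k : ℕ) < t := by
  induction t with
  | zero =>
    rw [W.pos_zero] at h
    exact absurd (C.isBlack_of_eq h) (C.isWhite_white _)
  | succ t ih =>
    by_cases hh : Hits τ ⟨t, ht⟩ s
    · have h2 := W.vertex_of_hits hh
      simp only at h2
      rw [h] at h2
      rw [C.black_injective h2]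
      exact Nat.lt_succ_self t
    · have h1 := W.pos_succ_of_not_hits hh
      simp only at h1
      rw [h1] at h
      exact (ih (by omega) h).trans (Nat.lt_succ_self t)

theorem exists_le_of_hits {t : ℕ} (ht : t ≤ r) {s : OutLabel ε} {u : Fin r} (hu : (u : ℕ) < t)
    (h : Hits τ u s) : ∃ k : Fin r, u ≤ k ∧ C.vertex (W.pos t s) = C.black k := by
  induction t with
  | zero => omega
  | succ t ih =>
    by_cases hh : Hits τ ⟨t, ht⟩ s
    · exact ⟨⟨t, ht⟩, Nat.lt_succ_iff.1 hu, W.vertex_of_hits hh⟩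
    · have hut : (u : ℕ) ≠ t := by
        rintro rfl
        exact hh h
      have h1 := W.pos_succ_of_not_hits hh
      simp only at h1
      rw [h1]
      exact ih (by omega) (by omega)

theorem pos_eq_of_not_hits {t t' : ℕ} (htt' : t ≤ t') (ht' : t' ≤ r) {s : OutLabel ε}
    (h : ∀ u : Fin r, t ≤ u → (u : ℕ) < t' → ¬ Hits τ u s) : W.pos t s = W.pos t' s := by
  induction t', htt' using Nat.le_induction with
  | base => rfl
  | succ t' htt' ih =>
    rw [ih (by omega) fun u hu hu' => h u hu (by omega)]
    exact (W.pos_succ_of_not_hits (h ⟨t', ht'⟩ htt' (Nat.lt_succ_self t'))).symm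

/-- Once a strand has visited `u ≥ t`, it stays at vertices numbered at least `u`, while `pos t s`
lies at a white vertex or at one numbered below `t`. Coincidences on a strand thus depend on `τ`
only. -/
theorem pos_eq_iff {t t' : ℕ} (htt' : t ≤ t') (ht' : t' ≤ r) {s : OutLabel ε} :
    W.pos t s = W.pos t' s ↔ ∀ u : Fin r, t ≤ u → (u : ℕ) < t' → ¬ Hits τ u s := by
  refine ⟨fun h u hu hu' hh => ?_, W.pos_eq_of_not_hits htt' ht'⟩
  obtain ⟨k, huk, hk⟩ := W.exists_le_of_hits ht' hu' hh
  rw [← h] at hk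
  have := W.lt_of_vertex_pos (htt'.trans ht') hk
  omega

theorem pos_eq_pos_of_sweep {D : UnitaryMap I r} (V : Sweep D τ π) {t t' : ℕ} (ht : t ≤ r)
    (ht' : t' ≤ r) {s s' : OutLabel ε} (h : W.pos t s = W.pos t' s') :
    V.pos t s = V.pos t' s' := by
  obtain rfl := W.eq_of_pos_eq ht ht' h
  rcases le_total t t' with htt' | htt'
  · rw [V.pos_eq_iff htt' ht', ← W.pos_eq_iff htt' ht', h]
  · exact ((V.pos_eq_iff htt' ht).2 ((W.pos_eq_iff htt' ht).1 h.symm)).symm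

theorem white_out (s : OutLabel ε) : (C.white s : C.HalfEdge) = W.pos 0 s := (W.pos_zero s).symm

theorem white_in (j : InLabel ε) : (C.white j : C.HalfEdge) = C.opp (W.pos r (π.symm j)) := by
  rw [W.opp_last, Equiv.apply_symm_apply]

/-! ### The isomorphism between two maps with the same sweep data -/

/-- The half-edges `pos t s` and their opposites. -/
def cell (x : Fin (r + 1) × OutLabel ε × Bool) : C.HalfEdge :=
  if x.2.2 then W.pos x.1 x.2.1 else C.opp (W.pos x.1 x.2.1)

theorem cell_surjective : Function.Surjective W.cell := by
  intro h
  rcases C.exists_white_or_black h with ⟨i, rfl⟩ | ⟨k, hk⟩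
  · rcases Int.units_eq_one_or (ε i) with hi | hi
    · exact ⟨(0, ⟨i, hi⟩, true), (W.white_out ⟨i, hi⟩).symm⟩
    · exact ⟨(Fin.last r, π.symm ⟨i, hi⟩, false), (W.white_in ⟨i, hi⟩).symm⟩
  · obtain ⟨s, -, rfl | rfl⟩ := W.exists_hits_of_vertex_eq hk
    · exact ⟨(k.succ, s, true), rfl⟩
    · exact ⟨(k.castSucc, s, false), rfl⟩

/-- Signs separate positions from their opposites and labels separate strands; the remaining
coincidences are dictated by `τ`, hence common to both maps. This makes `cellEquiv` well defined. -/
theorem cell_eq_of_sweep {D : UnitaryMap I r} (V : Sweep D τ π)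
    {x y : Fin (r + 1) × OutLabel ε × Bool} (h : W.cell x = W.cell y) : V.cell x = V.cell y := by
  obtain ⟨t, s, b⟩ := x
  obtain ⟨t', s', b'⟩ := y
  have ht := Fin.is_le t
  have ht' := Fin.is_le t'
  have hne : ∀ {t t' : Fin (r + 1)} {s s' : OutLabel ε}, W.pos t s ≠ C.opp (W.pos t' s') := by
    intro t t' s s' h
    have := congrArg C.sign h
    rw [C.sign_opp, W.sign_pos t.is_le, W.sign_pos t'.is_le] at this
    exact absurd this (by decide)
  cases b <;> cases b'
  · exact congrArg D.opp (W.pos_eq_pos_of_sweep V ht ht' (C.opp.injective h))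
  · exact absurd h.symm hne
  · exact absurd h hne
  · exact W.pos_eq_pos_of_sweep V ht ht' h

/-- The bijection between the half-edges of two maps with the same sweep data. -/
def cellEquiv {D : UnitaryMap I r} (V : Sweep D τ π) : C.HalfEdge ≃ D.HalfEdge where
  toFun h := V.cell (Function.surjInv W.cell_surjective h)
  invFun h := W.cell (Function.surjInv V.cell_surjective h)
  left_inv h := by
    exact (V.cell_eq_of_sweep W (Function.surjInv_eq V.cell_surjective _)).trans
      (Function.surjInv_eq W.cell_surjective h)
  right_inv h := by
    exact (W.cell_eq_of_sweep V (Function.surjInv_eq W.cell_surjective _)).trans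
      (Function.surjInv_eq V.cell_surjective h)

theorem cellEquiv_cell {D : UnitaryMap I r} (V : Sweep D τ π)
    (x : Fin (r + 1) × OutLabel ε × Bool) : W.cellEquiv V (W.cell x) = V.cell x :=
  W.cell_eq_of_sweep V (Function.surjInv_eq W.cell_surjective _)

theorem cellEquiv_pos {D : UnitaryMap I r} (V : Sweep D τ π) {t : ℕ} (ht : t ≤ r)
    (s : OutLabel ε) : W.cellEquiv V (W.pos t s) = V.pos t s :=
  W.cellEquiv_cell V (⟨t, by omega⟩, s, true)

theorem cellEquiv_opp_pos {D : UnitaryMap I r} (V : Sweep D τ π) {t : ℕ} (ht : t ≤ r)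
    (s : OutLabel ε) : W.cellEquiv V (C.opp (W.pos t s)) = D.opp (V.pos t s) :=
  W.cellEquiv_cell V (⟨t, by omega⟩, s, false)

theorem cellEquiv_white {D : UnitaryMap I r} (V : Sweep D τ π) (i : I) :
    W.cellEquiv V (C.white i) = D.white i := by
  rcases Int.units_eq_one_or (ε i) with hi | hi
  · exact (congrArg _ (W.white_out ⟨i, hi⟩)).trans
      ((W.cellEquiv_pos V (Nat.zero_le r) _).trans (V.white_out ⟨i, hi⟩).symm)
  · exact (congrArg _ (W.white_in ⟨i, hi⟩)).trans
      ((W.cellEquiv_opp_pos V le_rfl _).trans (V.white_in ⟨i, hi⟩).symm)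

/-- After the arrival of one strand comes the departure of the other: the source of the
transposition in `φ`. -/
theorem next_opp_pos [DecidableEq (OutLabel ε)] {t : Fin r} {s : OutLabel ε} (h : Hits τ t s) :
    C.next (C.opp (W.pos t s)) = W.pos (t + 1) (Equiv.swap (τ t).1 (τ t).2 s) := by
  rw [← W.next_of_hits h]
  rcases h with rfl | rfl
  · rw [W.next_next_fst, Equiv.swap_apply_left]
  · rw [W.next_next_snd, Equiv.swap_apply_right]

theorem vertex_cellEquiv {D : UnitaryMap I r} (V : Sweep D τ π) {h : C.HalfEdge} {k : Fin r}
    (hk : C.vertex h = C.black k) : D.vertex (W.cellEquiv V h) = D.black k := by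
  obtain ⟨s, hs, rfl | rfl⟩ := W.exists_hits_of_vertex_eq hk
  · rw [W.cellEquiv_pos V (by omega), V.vertex_of_hits hs]
  · rw [W.cellEquiv_opp_pos V (by omega), V.vertex_opp_of_hits hs]

/-- Two maps with the same sweep data and the same white vertices are isomorphic. -/
def iso {D : UnitaryMap I r} (V : Sweep D τ π) (hρ : C.rho = D.rho) : UnitaryMap.Iso C D where
  toEquiv := W.cellEquiv V
  map_next h := by
    classical
    rcases C.exists_white_or_black h with ⟨i, rfl⟩ | ⟨k, hk⟩
    · rw [C.next_white, W.cellEquiv_white, W.cellEquiv_white, D.next_white, hρ]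
    · obtain ⟨s, hs, rfl | rfl⟩ := W.exists_hits_of_vertex_eq hk
      · rw [W.next_of_hits hs, W.cellEquiv_opp_pos V (by omega), W.cellEquiv_pos V (by omega),
          V.next_of_hits hs]
      · rw [W.next_opp_pos hs, W.cellEquiv_opp_pos V (by omega), W.cellEquiv_pos V (by omega),
          V.next_opp_pos hs]
  map_opp h := by
    obtain ⟨⟨t, s, b⟩, rfl⟩ := W.cell_surjective h
    have ht := t.is_le
    cases b
    · change W.cellEquiv V (C.opp (C.opp (W.pos t s))) =
        D.opp (W.cellEquiv V (C.opp (W.pos t s)))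
      rw [W.cellEquiv_opp_pos V ht, C.opp_opp, D.opp_opp, W.cellEquiv_pos V ht]
    · change W.cellEquiv V (C.opp (W.pos t s)) = D.opp (W.cellEquiv V (W.pos t s))
      rw [W.cellEquiv_opp_pos V ht, W.cellEquiv_pos V ht]
  map_sign h := by
    obtain ⟨⟨t, s, b⟩, rfl⟩ := W.cell_surjective h
    have ht := t.is_le
    cases b
    · change D.sign (W.cellEquiv V (C.opp (W.pos t s))) = C.sign (C.opp (W.pos t s))
      rw [W.cellEquiv_opp_pos V ht, C.sign_opp, D.sign_opp, W.sign_pos ht, V.sign_pos ht]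
    · change D.sign (W.cellEquiv V (W.pos t s)) = C.sign (W.pos t s)
      rw [W.cellEquiv_pos V ht, W.sign_pos ht, V.sign_pos ht]
  map_isWhite h := by
    rcases C.exists_white_or_black h with ⟨i, rfl⟩ | ⟨k, hk⟩
    · rw [W.cellEquiv_white]
      exact iff_of_true (D.isWhite_white i) (C.isWhite_white i)
    · exact iff_of_false (fun h => h (D.isBlack_of_eq (W.vertex_cellEquiv V hk)))
        (fun h => h (C.isBlack_of_eq hk))
  map_black h k := by
    rcases C.exists_white_or_black h with ⟨i, rfl⟩ | ⟨l, hl⟩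
    · rw [W.cellEquiv_white]
      exact iff_of_false (fun h => D.isWhite_white i (D.isBlack_of_eq h))
        (fun h => C.isWhite_white i (C.isBlack_of_eq h))
    · rw [W.vertex_cellEquiv V hl, hl]
      exact ⟨fun h => by rw [D.black_injective h], fun h => by rw [C.black_injective h]⟩
  map_white := W.cellEquiv_white V

/-! ### Invariants of a map in terms of its sweep data -/

/-- The sweep of an isomorphic map. -/
def ofIso {D : UnitaryMap I r} (e : UnitaryMap.Iso C D) : Sweep D τ π where
  eps_eq := by
    rw [← W.eps_eq]
    funext i
    change D.sign (D.white i) = C.sign (C.white i)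
    rw [← e.map_white, e.map_sign]
  pos t s := e.toEquiv (W.pos t s)
  pos_zero s := by rw [W.pos_zero, e.map_white]
  pos_succ_of_ne t s h1 h2 := by rw [W.pos_succ_of_ne t s h1 h2]
  pos_succ_fst t := by rw [W.pos_succ_fst, e.map_face]
  pos_succ_snd t := by rw [W.pos_succ_snd, e.map_face]
  vertex_fst t := (e.map_black _ _).2 (W.vertex_fst t)
  next_next_fst t := by rw [← W.next_next_fst, e.map_next, e.map_next]
  opp_last s := by rw [← e.map_opp, W.opp_last, e.map_white]

/-- Equal positions at time `t` force equal visits, hence equal positions at time `t + 1`. Visits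
determine only the unordered pair `τ t`; the strict inequalities fix its order. -/
theorem data_unique {τ' : Fin r → OutLabel ε × OutLabel ε} {π' : OutLabel ε ≃ InLabel ε}
    [LinearOrder I] (W : Sweep C τ π) (V : Sweep C τ' π') (hτ : ∀ t, (τ t).1 < (τ t).2)
    (hτ' : ∀ t, (τ' t).1 < (τ' t).2) : τ = τ' ∧ π = π' := by
  have hstep : ∀ t : Fin r, (∀ s, W.pos t s = V.pos t s) → ∀ s, Hits τ t s ↔ Hits τ' t s :=
    fun t h s => by rw [W.hits_iff, V.hits_iff, h]
  have hpos : ∀ t ≤ r, ∀ s, W.pos t s = V.pos t s := by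
    intro t ht
    induction t with
    | zero => intro s; rw [W.pos_zero, V.pos_zero]
    | succ t ih =>
      have ih := ih (by omega)
      intro s
      by_cases h : Hits τ ⟨t, ht⟩ s
      · have h1 := W.pos_succ_of_hits h
        have h2 := V.pos_succ_of_hits ((hstep ⟨t, ht⟩ ih s).1 h)
        simp only at h1 h2
        rw [h1, h2, ih]
      · have h1 := W.pos_succ_of_not_hits h
        have h2 := V.pos_succ_of_not_hits fun hc => h ((hstep ⟨t, ht⟩ ih s).2 hc)
        simp only at h1 h2
        rw [h1, h2, ih]
  constructor
  · funext t
    have h := hstep t (hpos t (by omega))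
    have h1 := (h (τ t).1).1 (Or.inl rfl)
    have h2 := (h (τ t).2).1 (Or.inr rfl)
    have h3 := hτ t
    have h4 := hτ' t
    rcases h1 with h1 | h1 <;> rcases h2 with h2 | h2
    · rw [h1, h2] at h3
      exact absurd h3 (lt_irrefl _)
    · exact Prod.ext h1 h2
    · rw [h1, h2] at h3
      exact absurd h3 (lt_asymm h4)
    · rw [h1, h2] at h3
      exact absurd h3 (lt_irrefl _)
  · ext s
    have := W.opp_last s
    rw [hpos r le_rfl, V.opp_last] at this
    exact (C.white.injective (Subtype.ext this)).symm

/-- The outgoing half-edges at the vertex are those of its two strands and carry the labels of these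
strands. -/
theorem val_eq (W : Sweep C τ π) [LinearOrder I] (hτ : ∀ t, (τ t).1 < (τ t).2) (k : Fin r) :
    C.val k = (τ k).2 := by
  unfold UnitaryMap.val
  refine (Finset.max'_eq_iff _ _ _).2 ⟨?_, ?_⟩
  · rw [Finset.mem_image]
    exact ⟨W.pos (k + 1) (τ k).2, by simp [W.vertex_snd, W.sign_pos k.2], W.labelOf_pos k.2 _⟩
  · intro i hi
    rw [Finset.mem_image] at hi
    obtain ⟨h, hh, rfl⟩ := hi
    rw [Set.Finite.mem_toFinset] at hh
    obtain ⟨s, hs, rfl⟩ := W.exists_hits_of_sign_eq_one hh.1 hh.2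
    rw [W.labelOf_pos k.2]
    rcases hs with rfl | rfl
    · exact (hτ k).le
    · exact le_rfl

theorem phi_out (W : Sweep C τ π) (s : OutLabel ε) : C.phi s = C.rho⁻¹ (π s) := by
  refine UnitaryMap.Reaches.phi_eq ?_
  rw [W.white_out]
  -- Downward induction from the end of the strand: all its positions lead to the same white
  -- half-edge.
  refine Nat.decreasingInduction' (n := r) (m := 0)
    (P := fun t => C.Reaches (W.pos t s) (C.rho⁻¹ (π s))) ?_ (Nat.zero_le r) ?_
  · intro t ht _ ih
    by_cases h : Hits τ ⟨t, ht⟩ s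
    · have h1 := W.pos_succ_of_hits h
      have h2 := W.vertex_of_hits h
      simp only at h1 h2
      rw [h1] at ih h2
      exact ih.of_face (C.isBlack_of_eq h2)
    · have h1 := W.pos_succ_of_not_hits h
      simp only at h1
      rwa [h1] at ih
  · exact .of_face_eq (C.face_eq_white (W.opp_last s))

theorem face_opp_pos_succ [DecidableEq (OutLabel ε)] {t : Fin r} {s : OutLabel ε} (h : Hits τ t s) :
    C.face (C.opp (W.pos (t + 1) s)) =
      C.opp (W.pos t (Equiv.swap (τ t).1 (τ t).2 s)) := by
  apply C.next.injective
  have h' : Hits τ t (Equiv.swap (τ t).1 (τ t).2 s) := by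
    rcases h with rfl | rfl
    · exact Or.inr (Equiv.swap_apply_left _ _)
    · exact Or.inl (Equiv.swap_apply_right _ _)
  rw [C.next_face, C.opp_opp, W.next_opp_pos h', Equiv.swap_apply_self]

/-- Going backwards from time `t`, the face meets the vertices in decreasing order and changes
strand at each, so the last transposition acts first. At the start of a strand it turns to the
half-edge preceding that white half-edge, whence `ρ⁻¹`. -/
theorem reaches_opp_pos [DecidableEq (OutLabel ε)] {t : ℕ} (ht : t ≤ r) (s : OutLabel ε) :
    C.Reaches (C.opp (W.pos t s)) (C.rho⁻¹
      (((List.ofFn fun t => Equiv.swap (τ t).1 (τ t).2).take t).prod s : OutLabel ε)) := by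
  induction t generalizing s with
  | zero => exact .of_face_eq (C.face_eq_white (by simp [C.opp_opp, W.pos_zero]))
  | succ t ih =>
    have hprod : ((List.ofFn fun t => Equiv.swap (τ t).1 (τ t).2).take (t + 1)).prod s =
        ((List.ofFn fun t => Equiv.swap (τ t).1 (τ t).2).take t).prod
          (Equiv.swap (τ ⟨t, ht⟩).1 (τ ⟨t, ht⟩).2 s) := by
      rw [List.prod_take_succ _ _ (by simpa using ht), Equiv.Perm.mul_apply]
      simp
    rw [hprod]
    by_cases h : Hits τ ⟨t, ht⟩ s
    · have h1 := W.face_opp_pos_succ h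
      simp only at h1
      refine UnitaryMap.Reaches.of_face ?_ ?_
      · rw [C.vertex_face, C.opp_opp]
        exact C.isBlack_of_eq (W.vertex_of_hits h)
      · rw [h1]
        exact ih (by omega) _
    · have h1 := W.pos_succ_of_not_hits h
      simp only at h1
      rw [h1, Equiv.swap_apply_of_ne_of_ne (fun hc => h (Or.inl hc)) (fun hc => h (Or.inr hc))]
      exact ih (by omega) s

theorem phi_in [DecidableEq (OutLabel ε)] (W : Sweep C τ π) (s : OutLabel ε) : C.phi (π s) = C.rho⁻¹
    ((List.ofFn fun t => Equiv.swap (τ t).1 (τ t).2).prod s : OutLabel ε) := by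
  refine UnitaryMap.Reaches.phi_eq ?_
  rw [← W.opp_last]
  have := W.reaches_opp_pos le_rfl s
  rwa [List.take_of_length_le (by simp)] at this

end Sweep

/-! ## Existence of the sweep of a map -/

namespace UnitaryMap

variable {I : Type} {r : ℕ} (C : UnitaryMap I r)

open Classical in
/-- The strand that starts at the half-edge `h` and turns left at each vertex, before the black
vertex number `t`. -/
def strand (h : C.HalfEdge) : ℕ → C.HalfEdge
  | 0 => h
  | t + 1 => if ∃ k : Fin r, (k : ℕ) = t ∧ C.vertex (C.opp (strand h t)) = C.black k then
      C.face (strand h t) else strand h t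

variable {C}

theorem strand_succ_of_eq {h : C.HalfEdge} {t : Fin r}
    (ht : C.vertex (C.opp (C.strand h t)) = C.black t) :
    C.strand h (t + 1) = C.face (C.strand h t) := by
  rw [strand, if_pos ⟨t, rfl, ht⟩]

theorem strand_succ_of_ne {h : C.HalfEdge} {t : ℕ}
    (ht : ∀ k : Fin r, (k : ℕ) = t → C.vertex (C.opp (C.strand h t)) ≠ C.black k) :
    C.strand h (t + 1) = C.strand h t := by
  rw [strand, if_neg]
  rintro ⟨k, hk, h⟩
  exact ht k hk h

theorem strand_cases (h : C.HalfEdge) (t : ℕ) :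
    (∃ k : Fin r, (k : ℕ) = t ∧ C.vertex (C.opp (C.strand h t)) = C.black k ∧
      C.strand h (t + 1) = C.face (C.strand h t) ∧ C.vertex (C.strand h (t + 1)) = C.black k) ∨
    ((∀ k : Fin r, (k : ℕ) = t → C.vertex (C.opp (C.strand h t)) ≠ C.black k) ∧
      C.strand h (t + 1) = C.strand h t) := by
  by_cases hc : ∃ k : Fin r, (k : ℕ) = t ∧ C.vertex (C.opp (C.strand h t)) = C.black k
  · obtain ⟨k, rfl, hk⟩ := hc
    exact Or.inl ⟨k, rfl, hk, strand_succ_of_eq hk, by rw [strand_succ_of_eq hk, C.vertex_face, hk]⟩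
  · push Not at hc
    exact Or.inr ⟨hc, strand_succ_of_ne hc⟩

variable {i : I}

theorem sign_strand (hi : C.eps i = 1) (t : ℕ) : C.sign (C.strand (C.white i) t) = 1 := by
  induction t with
  | zero => exact hi
  | succ t ih =>
    rcases strand_cases (C.white i : C.HalfEdge) t with ⟨k, -, -, h1, h2⟩ | ⟨-, h1⟩
    · rw [h1] at h2 ⊢
      rw [C.sign_face (C.isBlack_of_eq h2), ih]
    · rw [h1, ih]

theorem labelOf_strand (i : I) (t : ℕ) : C.labelOf (C.strand (C.white i) t) = i := by
  induction t with
  | zero => exact C.labelOf_white i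
  | succ t ih =>
    rcases strand_cases (C.white i : C.HalfEdge) t with ⟨k, -, -, h1, h2⟩ | ⟨-, h1⟩
    · rw [h1] at h2 ⊢
      rw [C.labelOf_face (C.isBlack_of_eq h2), ih]
    · rw [h1, ih]

/-- Numbers increase along edges, so the sweep never passes a vertex that a strand still has to
visit. -/
theorem le_of_vertex_opp_strand (hi : C.eps i = 1) {t : ℕ} {k : Fin r}
    (h : C.vertex (C.opp (C.strand (C.white i) t)) = C.black k) : t ≤ (k : ℕ) := by
  induction t with
  | zero => exact Nat.zero_le _
  | succ t ih =>
    rcases strand_cases (C.white i : C.HalfEdge) t with ⟨l, hl, -, -, h2⟩ | ⟨h1, h2⟩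
    · have := C.number_lt _ _ _ (sign_strand hi (t + 1)) h2 h
      omega
    · rw [h2] at h
      have h3 := ih h
      have h4 : (k : ℕ) ≠ t := fun hk => h1 k hk h
      omega

/-- The strands at time `t` fill the cut between the vertices numbered below `t` and the others:
each edge leading across it, white ends being allowed on both sides, lies on a strand. -/
theorem exists_strand_eq {t : ℕ} (ht : t ≤ r) {h : C.HalfEdge} (hs : C.sign h = 1)
    (hlt : ∀ k : Fin r, C.vertex h = C.black k → (k : ℕ) < t)
    (hle : ∀ k : Fin r, C.vertex (C.opp h) = C.black k → t ≤ (k : ℕ)) :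
    ∃ i, C.eps i = 1 ∧ C.strand (C.white i) t = h := by
  induction t generalizing h with
  | zero =>
    rcases C.exists_white_or_black h with ⟨i, rfl⟩ | ⟨k, hk⟩
    · exact ⟨i, hs, rfl⟩
    · exact absurd (hlt k hk) (Nat.not_lt_zero _)
  | succ t ih =>
    let u : Fin r := ⟨t, ht⟩
    by_cases hu : C.vertex h = C.black u
    -- If `h` leaves the vertex just swept, its predecessor on the strand is `C.opp (C.next h)`,
    -- which lies in the previous cut.
    · have hface : C.face (C.opp (C.next h)) = h := by
        apply C.next.injective
        rw [C.next_face, C.opp_opp]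
      have hb : C.vertex (C.opp (C.opp (C.next h))) = C.black u := by
        rw [C.opp_opp, C.vertex_next, hu]
      have hs' : C.sign (C.opp (C.next h)) = 1 := by
        rw [C.sign_opp, C.alternated_black h (C.isBlack_of_eq hu), neg_neg, hs]
      obtain ⟨i, hi, hti⟩ := ih (by omega) hs'
        (fun k hk => C.number_lt _ _ _ hs' hk hb)
        (fun k hk => by rw [hb] at hk; rw [← C.black_injective hk])
      refine ⟨i, hi, ?_⟩
      have := strand_succ_of_eq (C := C) (h := C.white i) (t := u) (by rw [hti, hb])
      simp only [u] at this
      rw [this, hti, hface]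
    · have hlt' : ∀ k : Fin r, C.vertex h = C.black k → (k : ℕ) < t := fun k hk => by
        have h1 := hlt k hk
        have h2 : (k : ℕ) ≠ t := fun hkt => hu (by rw [hk, Fin.ext (b := u) hkt])
        omega
      obtain ⟨i, hi, hti⟩ := ih (by omega) hs hlt'
        (fun k hk => (Nat.le_succ t).trans (hle k hk))
      refine ⟨i, hi, ?_⟩
      rw [strand_succ_of_ne, hti]
      intro k hk hkb
      rw [hti] at hkb
      have := hle k hkb
      omega

theorem exists_strand_of_vertex_eq {h : C.HalfEdge} {t : Fin r} (hs : C.sign h = -1)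
    (ht : C.vertex h = C.black t) : ∃ i, C.eps i = 1 ∧ C.opp (C.strand (C.white i) t) = h := by
  have hs' : C.sign (C.opp h) = 1 := by rw [C.sign_opp, hs, neg_neg]
  obtain ⟨i, hi, hti⟩ := exists_strand_eq t.2.le hs'
    (fun k hk => C.number_lt _ _ _ hs' hk (by rw [C.opp_opp, ht]))
    (fun k hk => by rw [C.opp_opp, ht] at hk; rw [C.black_injective hk])
  exact ⟨i, hi, by rw [hti, C.opp_opp]⟩

/-- Both ingoing half-edges at vertex `t` lie in the cut at time `t`, so each is reached by a
strand, unique since its label is known. -/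
theorem exists_strand_pair (t : Fin r) : ∃ i j, C.eps i = 1 ∧ C.eps j = 1 ∧ i ≠ j ∧
    C.vertex (C.opp (C.strand (C.white i) t)) = C.black t ∧
    C.vertex (C.opp (C.strand (C.white j) t)) = C.black t ∧
    C.next (C.next (C.face (C.strand (C.white i) t))) = C.face (C.strand (C.white j) t) ∧
    ∀ k, C.eps k = 1 → C.vertex (C.opp (C.strand (C.white k) t)) = C.black t → k = i ∨ k = j := by
  obtain ⟨h, hh, hs⟩ := C.exists_outgoing t
  have hb := C.isBlack_of_eq hh
  have h1 : C.vertex (C.next h) = C.black t := by rw [C.vertex_next, hh]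
  have h2 : C.vertex (C.next (C.next h)) = C.black t := by rw [C.vertex_next, h1]
  have h3 : C.vertex (C.next (C.next (C.next h))) = C.black t := by rw [C.vertex_next, h2]
  have s1 : C.sign (C.next h) = -1 := by rw [C.alternated_black h hb, hs]
  have s2 : C.sign (C.next (C.next h)) = 1 := by
    rw [C.alternated_black _ (C.isBlack_of_eq h1), s1, neg_neg]
  have s3 : C.sign (C.next (C.next (C.next h))) = -1 := by
    rw [C.alternated_black _ (C.isBlack_of_eq h2), s2]
  obtain ⟨i, hi, hti⟩ := exists_strand_of_vertex_eq s1 h1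
  obtain ⟨j, hj, htj⟩ := exists_strand_of_vertex_eq s3 h3
  have f1 : C.face (C.strand (C.white i) t) = h := by
    apply C.next.injective
    rw [C.next_face, hti]
  have f2 : C.face (C.strand (C.white j) t) = C.next (C.next h) := by
    apply C.next.injective
    rw [C.next_face, htj]
  refine ⟨i, j, hi, hj, ?_, by rw [hti, h1], by rw [htj, h3], by rw [f1, f2], ?_⟩
  · rintro rfl
    exact C.next_two_ne hb (f2.symm.trans f1)
  · intro k hk hkt
    have hks : C.sign (C.opp (C.strand (C.white k) t)) = -1 := by
      rw [C.sign_opp, sign_strand hk]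
    rcases C.eq_of_vertex_eq hb (hkt.trans hh.symm) with h4 | h4 | h4 | h4
    · rw [h4, hs] at hks
      exact absurd hks (by decide)
    · left
      rw [← hti] at h4
      rw [← C.labelOf_strand k t, C.opp.injective h4, labelOf_strand]
    · rw [h4, s2] at hks
      exact absurd hks (by decide)
    · right
      rw [← htj] at h4
      rw [← C.labelOf_strand k t, C.opp.injective h4, labelOf_strand]

theorem exists_ordered_strand_pair [LinearOrder I] (t : Fin r) :
    ∃ i j, C.eps i = 1 ∧ C.eps j = 1 ∧ i < j ∧
    C.vertex (C.opp (C.strand (C.white i) t)) = C.black t ∧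
    C.vertex (C.opp (C.strand (C.white j) t)) = C.black t ∧
    C.next (C.next (C.face (C.strand (C.white i) t))) = C.face (C.strand (C.white j) t) ∧
    ∀ k, C.eps k = 1 → C.vertex (C.opp (C.strand (C.white k) t)) = C.black t → k = i ∨ k = j := by
  obtain ⟨i, j, hi, hj, hij, h1, h2, h3, h4⟩ := exists_strand_pair (C := C) t
  rcases lt_or_gt_of_ne hij with h | h
  · exact ⟨i, j, hi, hj, h, h1, h2, h3, h4⟩
  · refine ⟨j, i, hj, hi, h, h2, h1, ?_, fun k hk hkt => (h4 k hk hkt).symm⟩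
    rw [← h3]
    refine C.next_four (C.isBlack_of_eq (k := t) ?_)
    rw [C.vertex_face, h1]

theorem exists_opp_strand_last (hi : C.eps i = 1) :
    ∃ j, C.eps j = -1 ∧ C.opp (C.strand (C.white i) r) = C.white j := by
  rcases C.exists_white_or_black (C.opp (C.strand (C.white i) r)) with ⟨j, hj⟩ | ⟨k, hk⟩
  · refine ⟨j, ?_, hj⟩
    change C.sign (C.white j) = -1
    rw [← hj, C.sign_opp, sign_strand hi]
  · exact absurd k.2 (not_lt.2 (le_of_vertex_opp_strand hi hk))

/-- Each map of unitary type can be swept. -/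
theorem exists_sweep [LinearOrder I] {ε : I → ℤˣ} (hε : C.eps = ε) :
    ∃ (τ : Fin r → OutLabel ε × OutLabel ε) (π : OutLabel ε ≃ InLabel ε),
      (∀ t, (τ t).1 < (τ t).2) ∧ Nonempty (Sweep C τ π) := by
  subst hε
  choose a b ha hb hab hva hvb hnext huniq using exists_ordered_strand_pair (C := C)
  choose f hf hfopp using fun s : OutLabel C.eps => exists_opp_strand_last s.2
  let π₀ : OutLabel C.eps → InLabel C.eps := fun s => ⟨f s, hf s⟩
  -- Injectivity follows from the labels, surjectivity from the cut at time `r`, whose edges all end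
  -- at white vertices.
  have hπ : Function.Bijective π₀ := by
    constructor
    · intro s s' h
      have h1 : f s = f s' := congrArg Subtype.val h
      have h2 := hfopp s
      rw [h1, ← hfopp s'] at h2
      apply Subtype.ext
      rw [← C.labelOf_strand s r, C.opp.injective h2, labelOf_strand]
    · rintro ⟨j, hj⟩
      have hs : C.sign (C.opp (C.white j)) = 1 := by
        rw [C.sign_opp]
        exact neg_eq_iff_eq_neg.2 hj
      obtain ⟨i, hi, hti⟩ := exists_strand_eq le_rfl hs (fun k _ => k.2) (fun k hk => by
        rw [C.opp_opp] at hk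
        exact absurd (C.isBlack_of_eq hk) (C.isWhite_white j))
      refine ⟨⟨i, hi⟩, Subtype.ext ?_⟩
      apply C.white.injective
      apply Subtype.ext
      change (C.white (f ⟨i, hi⟩) : C.HalfEdge) = C.white j
      rw [← hfopp, hti, C.opp_opp]
  refine ⟨fun t => (⟨a t, ha t⟩, ⟨b t, hb t⟩), Equiv.ofBijective π₀ hπ, hab, ⟨?_⟩⟩
  exact
    { eps_eq := rfl
      pos := fun t s => C.strand (C.white s) t
      pos_zero := fun s => rfl
      pos_succ_of_ne := fun t s h1 h2 => strand_succ_of_ne fun k hk hkt => by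
        obtain rfl := Fin.ext hk
        rcases huniq k s s.2 hkt with h | h
        · exact h1 (Subtype.ext h)
        · exact h2 (Subtype.ext h)
      pos_succ_fst := fun t => strand_succ_of_eq (hva t)
      pos_succ_snd := fun t => strand_succ_of_eq (hvb t)
      vertex_fst := fun t => by rw [strand_succ_of_eq (hva t), C.vertex_face, hva]
      next_next_fst := fun t => by
        rw [strand_succ_of_eq (hva t), strand_succ_of_eq (hvb t), hnext]
      opp_last := fun s => hfopp s }

end UnitaryMap

/-! ## The map with given sweep data -/

namespace StrandModel

variable {I : Type} {r : ℕ} {ε : I → ℤˣ}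

/-! ### Positions on abstract strands -/

section Positions

variable (τ : Fin r → OutLabel ε × OutLabel ε)

/-- The positions on the strands: the start of a strand, or a visit of a black vertex by the first
(`true`) or the second (`false`) of its two strands. -/
abbrev Position (ε : I → ℤˣ) (r : ℕ) : Type := OutLabel ε ⊕ Fin r × Bool

/-- The strand of a position. -/
def strandOf : Position ε r → OutLabel ε
  | Sum.inl s => s
  | Sum.inr (t, true) => (τ t).1
  | Sum.inr (t, false) => (τ t).2

open Classical in
/-- The last position of the strand `s` before the black vertex number `t`. -/
def current : ℕ → OutLabel ε → Position ε r
  | 0, s => Sum.inl s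
  | t + 1, s => if h : t < r then
      if s = (τ ⟨t, h⟩).1 then Sum.inr (⟨t, h⟩, true)
      else if s = (τ ⟨t, h⟩).2 then Sum.inr (⟨t, h⟩, false)
      else current t s
    else current t s

/-- One more than the number of the black vertex of a position, `0` for the start of a strand. -/
def time : Position ε r → ℕ
  | Sum.inl _ => 0
  | Sum.inr (t, _) => t + 1

/-- The position that precedes a given one on its strand, cyclically. -/
def previous (x : Position ε r) : Position ε r :=
  match x with
  | Sum.inl s => current τ r s
  | Sum.inr (t, b) => current τ t (strandOf τ (Sum.inr (t, b)))

theorem current_succ_cases (t : ℕ) (s : OutLabel ε) :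
    (∃ (h : t < r) (b : Bool), s = strandOf τ (Sum.inr (⟨t, h⟩, b)) ∧
      current τ (t + 1) s = Sum.inr (⟨t, h⟩, b)) ∨ current τ (t + 1) s = current τ t s := by
  rw [current]
  split_ifs with h h1 h2
  · exact Or.inl ⟨h, true, h1, rfl⟩
  · exact Or.inl ⟨h, false, h2, rfl⟩
  · exact Or.inr rfl
  · exact Or.inr rfl

theorem current_succ_of_ne (t : Fin r) {s : OutLabel ε} (h1 : s ≠ (τ t).1) (h2 : s ≠ (τ t).2) :
    current τ (t + 1) s = current τ t s := by
  rw [current, dif_pos t.2, if_neg h1, if_neg h2]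

theorem strandOf_current (t : ℕ) (s : OutLabel ε) : strandOf τ (current τ t s) = s := by
  induction t with
  | zero => rfl
  | succ t ih =>
    rcases current_succ_cases τ t s with ⟨h, b, hs, hc⟩ | hc
    · rw [hc, ← hs]
    · rw [hc, ih]

theorem time_current_le (t : ℕ) (s : OutLabel ε) : time (current τ t s) ≤ t := by
  induction t with
  | zero => exact le_rfl
  | succ t ih =>
    rcases current_succ_cases τ t s with ⟨h, b, hs, hc⟩ | hc
    · rw [hc]
      exact le_rfl
    · rw [hc]
      omega

theorem time_current_mono (s : OutLabel ε) : Monotone fun t => time (current τ t s) := by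
  refine monotone_nat_of_le_succ fun t => ?_
  rcases current_succ_cases τ t s with ⟨h, b, hs, hc⟩ | hc
  · change time (current τ t s) ≤ time (current τ (t + 1) s)
    rw [hc]
    exact (time_current_le τ t s).trans (Nat.le_succ t)
  · rw [hc]

variable {τ}

theorem current_succ_strandOf (hτ : ∀ t, (τ t).1 ≠ (τ t).2) (t : Fin r) (b : Bool) :
    current τ (t + 1) (strandOf τ (Sum.inr (t, b))) = Sum.inr (t, b) := by
  rw [current, dif_pos t.2]
  cases b
  · exact (if_neg (hτ t).symm).trans (if_pos rfl)
  · exact if_pos rfl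

theorem time_previous_lt (hτ : ∀ t, (τ t).1 ≠ (τ t).2) {t : Fin r} {b : Bool} {u : ℕ}
    (hu : (t : ℕ) < u) : time (previous τ (Sum.inr (t, b))) <
      time (current τ u (strandOf τ (Sum.inr (t, b)))) := by
  have h1 := time_current_le τ t (strandOf τ (Sum.inr (t, b)))
  have h2 := time_current_mono τ (strandOf τ (Sum.inr (t, b))) (Nat.succ_le_of_lt hu)
  simp only [Nat.succ_eq_add_one, current_succ_strandOf hτ t b] at h2
  change (t : ℕ) + 1 ≤ _ at h2
  exact lt_of_le_of_lt h1 h2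

theorem strandOf_previous (x : Position ε r) : strandOf τ (previous τ x) = strandOf τ x := by
  rcases x with s | ⟨t, b⟩ <;> exact strandOf_current _ _ _

/-- On one strand time increases strictly from a position to the next: the predecessor of the
earlier visit comes before that visit, and the predecessor of the later one does not. The strands of
a vertex being distinct excludes equal times. -/
theorem previous_injective (hτ : ∀ t, (τ t).1 ≠ (τ t).2) : Function.Injective (previous τ) := by
  intro x y h
  have hs : strandOf τ x = strandOf τ y := by
    rw [← strandOf_previous x, h, strandOf_previous]
  rcases x with s | ⟨t, b⟩ <;> rcases y with s' | ⟨t', b'⟩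
  · exact congrArg Sum.inl hs
  · have := time_previous_lt hτ (b := b') t'.2
    rw [← hs] at this
    exact absurd (congrArg time h) this.ne'
  · have := time_previous_lt hτ (b := b) t.2
    rw [hs] at this
    exact absurd (congrArg time h) this.ne
  · rcases lt_trichotomy t t' with htt | rfl | htt
    · have := time_previous_lt hτ (b := b) (u := t') htt
      rw [hs] at this
      exact absurd (congrArg time h) this.ne
    · cases b <;> cases b'
      · rfl
      · exact absurd hs.symm (hτ t)
      · exact absurd hs (hτ t)
      · rfl
    · have := time_previous_lt hτ (b := b') (u := t) htt
      rw [← hs] at this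
      exact absurd (congrArg time h) this.ne'

/-- The permutation `previous`. -/
def previousPerm [Finite I] (hτ : ∀ t, (τ t).1 ≠ (τ t).2) : Equiv.Perm (Position ε r) :=
  Equiv.ofBijective (previous τ) (Finite.injective_iff_bijective.1 (previous_injective hτ))

end Positions

/-- The half-edges: the white ones, and the outgoing (`true`) and ingoing (`false`) ones at each
visit of a black vertex. -/
abbrev Dart (I : Type) (r : ℕ) : Type := I ⊕ Fin r × Bool × Bool

/-- The outgoing half-edge that follows a position. -/
def outDart : Position ε r → Dart I r
  | Sum.inl s => Sum.inl s
  | Sum.inr (t, b) => Sum.inr (t, b, true)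

/-- The ingoing half-edge that precedes a position, the end of the strand for its start. -/
def inDart (π : OutLabel ε ≃ InLabel ε) : Position ε r → Dart I r
  | Sum.inl s => Sum.inl (π s)
  | Sum.inr (t, b) => Sum.inr (t, b, false)

/-- The signs of the half-edges. -/
def dartSign (ε : I → ℤˣ) : Dart I r → ℤˣ
  | Sum.inl i => ε i
  | Sum.inr (_, _, o) => if o then 1 else -1

theorem dartSign_outDart (x : Position ε r) : dartSign ε (outDart x) = 1 := by
  rcases x with s | ⟨t, b⟩
  · exact s.2
  · rfl

theorem dartSign_inDart (π : OutLabel ε ≃ InLabel ε) (x : Position ε r) :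
    dartSign ε (inDart π x) = -1 := by
  rcases x with s | ⟨t, b⟩
  · exact (π s).2
  · rfl

theorem sumElim_dart_bijective (π : OutLabel ε ≃ InLabel ε) :
    Function.Bijective (Sum.elim (outDart (ε := ε) (r := r)) (inDart π)) := by
  constructor
  · have hne : ∀ x y : Position ε r, outDart x ≠ inDart π y := fun x y h => by
      have := congrArg (dartSign ε) h
      rw [dartSign_outDart, dartSign_inDart] at this
      exact absurd this (by decide)
    rintro (x | x) (y | y) h
    · rcases x with s | ⟨t, b⟩ <;> rcases y with s' | ⟨t', b'⟩ <;>
        simp_all [outDart, Subtype.ext_iff]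
    · exact absurd h (hne x y)
    · exact absurd h.symm (hne y x)
    · rcases x with s | ⟨t, b⟩ <;> rcases y with s' | ⟨t', b'⟩ <;>
        simp_all [inDart, ← Subtype.ext_iff]
  · rintro (i | ⟨t, b, o⟩)
    · rcases Int.units_eq_one_or (ε i) with hi | hi
      · exact ⟨Sum.inl (Sum.inl ⟨i, hi⟩), rfl⟩
      · exact ⟨Sum.inr (Sum.inl (π.symm ⟨i, hi⟩)), by simp [inDart]⟩
    · cases o
      · exact ⟨Sum.inr (Sum.inr (t, b)), rfl⟩
      · exact ⟨Sum.inl (Sum.inr (t, b)), rfl⟩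

/-- The half-edges as outgoing and ingoing half-edges of positions. -/
def dartEquiv (π : OutLabel ε ≃ InLabel ε) : Position ε r ⊕ Position ε r ≃ Dart I r :=
  Equiv.ofBijective _ (sumElim_dart_bijective π)

/-- The rotation around the black vertices. -/
def blackNext (r : ℕ) : Equiv.Perm (Fin r × Bool × Bool) where
  -- The cyclic order is: first strand out, first strand in, second strand out, second strand in.
  toFun x := (x.1, if x.2.2 then x.2.1 else !x.2.1, !x.2.2)
  invFun x := (x.1, if x.2.2 then !x.2.1 else x.2.1, !x.2.2)
  left_inv := by rintro ⟨t, _ | _, _ | _⟩ <;> rfl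
  right_inv := by rintro ⟨t, _ | _, _ | _⟩ <;> rfl

/-- The black vertex of a half-edge, if any. -/
def dartVertex : Dart I r → Option (Fin r)
  | Sum.inl _ => none
  | Sum.inr x => some x.1

/-- This invariant of the rotation tells black vertices from each other and from white ones. -/
theorem dartVertex_next_pow (ρ : Equiv.Perm I) (n : ℕ) (h : Dart I r) :
    dartVertex ((Equiv.sumCongr ρ (blackNext r) ^ n : Equiv.Perm (Dart I r)) h) =
      dartVertex h := by
  induction n with
  | zero => rfl
  | succ n ih =>
    rw [pow_succ', Equiv.Perm.mul_apply, ← ih]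
    rcases (Equiv.sumCongr ρ (blackNext r) ^ n : Equiv.Perm (Dart I r)) h with i | x <;> rfl

/-! ### Edges, vertices and colours of the model -/

variable [Finite I] {τ : Fin r → OutLabel ε × OutLabel ε} (hτ : ∀ t, (τ t).1 ≠ (τ t).2)
  (π : OutLabel ε ≃ InLabel ε) (ρ : Equiv.Perm I)

/-- The exchange of the half-edges of an edge. -/
def dartOpp : Equiv.Perm (Dart I r) :=
  (dartEquiv π).permCongr
    { toFun := Sum.elim (fun x => Sum.inr ((previousPerm hτ).symm x))
        fun x => Sum.inl (previousPerm hτ x)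
      invFun := Sum.elim (fun x => Sum.inr ((previousPerm hτ).symm x))
        fun x => Sum.inl (previousPerm hτ x)
      left_inv := by rintro (x | x) <;> simp
      right_inv := by rintro (x | x) <;> simp }

theorem dartOpp_inDart (x : Position ε r) :
    dartOpp hτ π (inDart π x) = outDart (previous τ x) := by
  have h : inDart π x = dartEquiv π (Sum.inr x) := rfl
  rw [h, dartOpp, Equiv.permCongr_apply, Equiv.symm_apply_apply]
  rfl

theorem dartOpp_outDart_previous (x : Position ε r) :
    dartOpp hτ π (outDart (previous τ x)) = inDart π x := by
  have h : outDart (previous τ x) = dartEquiv π (Sum.inl (previousPerm hτ x)) := rfl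
  rw [h, dartOpp, Equiv.permCongr_apply, Equiv.symm_apply_apply]
  change dartEquiv π (Sum.inr ((previousPerm hτ).symm (previousPerm hτ x))) = _
  rw [Equiv.symm_apply_apply]
  rfl

theorem dart_cases {τ : Fin r → OutLabel ε × OutLabel ε} (hτ : ∀ t, (τ t).1 ≠ (τ t).2)
    (π : OutLabel ε ≃ InLabel ε) (h : Dart I r) :
    (∃ x, h = outDart (previous τ x)) ∨ ∃ x : Position ε r, h = inDart π x := by
  obtain ⟨x | x, rfl⟩ := (sumElim_dart_bijective π).2 h
  · obtain ⟨y, rfl⟩ := (previousPerm hτ).surjective x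
    exact Or.inl ⟨y, rfl⟩
  · exact Or.inr ⟨x, rfl⟩

/-- The oriented map underlying the map with given sweep data. -/
def orientedMap : OrientedMap where
  HalfEdge := Dart I r
  finite := inferInstance
  next := Equiv.sumCongr ρ (blackNext r)
  opp := dartOpp hτ π
  opp_opp h := by
    rcases dart_cases hτ π h with ⟨x, rfl⟩ | ⟨x, rfl⟩
    · rw [dartOpp_outDart_previous, dartOpp_inDart]
    · rw [dartOpp_inDart, dartOpp_outDart_previous]
  opp_ne h hc := by
    have := congrArg (dartSign ε) hc
    rcases dart_cases hτ π h with ⟨x, rfl⟩ | ⟨x, rfl⟩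
    · rw [dartOpp_outDart_previous, dartSign_outDart, dartSign_inDart] at this
      exact absurd this (by decide)
    · rw [dartOpp_inDart, dartSign_outDart, dartSign_inDart] at this
      exact absurd this (by decide)
  sign := dartSign ε
  sign_opp h := by
    rcases dart_cases hτ π h with ⟨x, rfl⟩ | ⟨x, rfl⟩
    · rw [dartOpp_outDart_previous, dartSign_outDart, dartSign_inDart]
    · rw [dartOpp_inDart, dartSign_outDart, dartSign_inDart, neg_neg]

theorem dartVertex_eq_of_vertex_eq {h h' : Dart I r}
    (hh : (orientedMap hτ π ρ).vertex h = (orientedMap hτ π ρ).vertex h') :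
    dartVertex h = dartVertex h' := by
  have hc : (orientedMap hτ π ρ).next.SameCycle h h' :=
    Quotient.exact (s := Equiv.Perm.SameCycle.setoid (orientedMap hτ π ρ).next) hh
  obtain ⟨n, -, hn⟩ := hc.exists_pow_eq'
  have := dartVertex_next_pow ρ n h
  rw [← this]
  exact congrArg dartVertex hn

theorem vertex_inr (t : Fin r) (b o : Bool) :
    (orientedMap hτ π ρ).vertex (Sum.inr (t, b, o) : Dart I r) =
      (orientedMap hτ π ρ).vertex (Sum.inr (t, true, true) : Dart I r) := by
  have h : ∀ x, (orientedMap hτ π ρ).vertex (Sum.inr (blackNext r x) : Dart I r) =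
      (orientedMap hτ π ρ).vertex (Sum.inr x : Dart I r) := fun x =>
    (orientedMap hτ π ρ).vertex_next (Sum.inr x : Dart I r)
  have h1 := h (t, true, true)
  have h2 := h (t, true, false)
  have h3 := h (t, false, true)
  cases b <;> cases o
  · exact h3.trans (h2.trans h1)
  · exact h2.trans h1
  · exact h1
  · rfl

/-- The property of being a black vertex. -/
def IsBlackVertex (v : (orientedMap hτ π ρ).Vertex) : Prop :=
  ∃ t : Fin r, v = (orientedMap hτ π ρ).vertex (Sum.inr (t, true, true) : Dart I r)

theorem isBlackVertex_iff (h : Dart I r) :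
    IsBlackVertex hτ π ρ ((orientedMap hτ π ρ).vertex h) ↔ ∃ x, h = Sum.inr x := by
  constructor
  · rintro ⟨t, ht⟩
    have := dartVertex_eq_of_vertex_eq hτ π ρ ht
    rcases h with i | x
    · simp [dartVertex] at this
    · exact ⟨x, rfl⟩
  · rintro ⟨⟨t, b, o⟩, rfl⟩
    exact ⟨t, vertex_inr hτ π ρ t b o⟩

theorem vertex_inr_eq_iff {t : Fin r} {h : Dart I r} :
    (orientedMap hτ π ρ).vertex h =
      (orientedMap hτ π ρ).vertex (Sum.inr (t, true, true) : Dart I r) ↔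
    ∃ b o, h = Sum.inr (t, b, o) := by
  constructor
  · intro hh
    have := dartVertex_eq_of_vertex_eq hτ π ρ hh
    rcases h with i | ⟨t', b, o⟩
    · simp [dartVertex] at this
    · simp only [dartVertex, Option.some.injEq] at this
      exact ⟨b, o, by rw [this]⟩
  · rintro ⟨b, o, rfl⟩
    exact vertex_inr hτ π ρ t b o

/-- The map with given sweep data. -/
def toMap : UnitaryMap I r where
  toOrientedMap := orientedMap hτ π ρ
  IsBlack := IsBlackVertex hτ π ρ
  black := Equiv.ofBijective (fun t => ⟨_, t, rfl⟩) (by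
    constructor
    · intro t t' h
      have := dartVertex_eq_of_vertex_eq hτ π ρ (congrArg Subtype.val h)
      simpa [dartVertex] using this
    · rintro ⟨_, t, rfl⟩
      exact ⟨t, rfl⟩)
  degree_black := by
    rintro _ ⟨t, rfl⟩
    have hbij : Function.Bijective (fun x : Bool × Bool =>
        (⟨(Sum.inr (t, x.1, x.2) : Dart I r), vertex_inr hτ π ρ t x.1 x.2⟩ :
          {h : Dart I r // (orientedMap hτ π ρ).vertex h =
            (orientedMap hτ π ρ).vertex (Sum.inr (t, true, true) : Dart I r)})) := by
      constructor
      · rintro ⟨b, o⟩ ⟨b', o'⟩ h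
        simpa using h
      · rintro ⟨h, hh⟩
        obtain ⟨b, o, rfl⟩ := (vertex_inr_eq_iff hτ π ρ).1 hh
        exact ⟨(b, o), rfl⟩
    refine (Nat.card_eq_of_bijective _ hbij).symm.trans ?_
    simp
  alternated_black h hb := by
    obtain ⟨⟨t, b, o⟩, rfl⟩ := (isBlackVertex_iff hτ π ρ h).1 hb
    cases b <;> cases o <;> rfl
  white := Equiv.ofBijective (fun i => ⟨(Sum.inl i : Dart I r), fun hb => by
      obtain ⟨x, hx⟩ := (isBlackVertex_iff hτ π ρ _).1 hb
      exact absurd hx (by simp)⟩) (by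
    constructor
    · intro i j h
      exact Sum.inl_injective (congrArg Subtype.val h)
    · rintro ⟨i | x, hb⟩
      · exact ⟨i, rfl⟩
      · exact absurd ((isBlackVertex_iff hτ π ρ _).2 ⟨x, rfl⟩) hb)
  number_lt h k l hs hk hl := by
    obtain ⟨b, o, rfl⟩ := (vertex_inr_eq_iff hτ π ρ).1 hk
    obtain ⟨b', o', hl'⟩ := (vertex_inr_eq_iff hτ π ρ).1 hl
    change dartOpp hτ π _ = _ at hl'
    rcases dart_cases hτ π (Sum.inr (k, b, o) : Dart I r) with ⟨x, hx⟩ | ⟨x, hx⟩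
    · rw [hx, dartOpp_outDart_previous] at hl'
      rcases x with s | ⟨t, c⟩
      · simp [inDart] at hl'
      · simp only [inDart, Sum.inr.injEq, Prod.mk.injEq] at hl'
        obtain rfl := hl'.1
        -- The edge starts at the predecessor of a visit of `t`, whose time is at most `t`; at a
        -- black vertex the time is one more than the number, so the inequality is strict.
        have h1 := time_current_le τ t (strandOf τ (Sum.inr (t, c)))
        change time (previous τ (Sum.inr (t, c))) ≤ t at h1
        generalize previous τ (Sum.inr (t, c)) = y at hx h1
        rcases y with s | ⟨u, d⟩
        · simp [outDart] at hx
        · simp only [outDart, Sum.inr.injEq, Prod.mk.injEq] at hx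
          obtain rfl := hx.1
          exact h1
    · have hs' : dartSign ε (Sum.inr (k, b, o)) = 1 := hs
      rw [hx, dartSign_inDart] at hs'
      exact absurd hs' (by decide)

theorem toMap_rho : (toMap hτ π ρ).rho = ρ := by
  ext i
  apply (toMap hτ π ρ).white.injective
  apply Subtype.ext
  rw [← UnitaryMap.next_white]
  rfl

theorem toMap_eps : (toMap hτ π ρ).eps = ε := rfl

theorem next_outDart (t : Fin r) (b : Bool) :
    (toMap hτ π ρ).next (outDart (Sum.inr (t, b) : Position ε r)) =
      inDart π (Sum.inr (t, b) : Position ε r) := by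
  cases b <;> rfl

theorem face_outDart_previous (t : Fin r) (b : Bool) :
    (toMap hτ π ρ).face (outDart (previous τ (Sum.inr (t, b))) : Dart I r) =
      outDart (Sum.inr (t, b) : Position ε r) :=
  (toMap hτ π ρ).next.injective (((toMap hτ π ρ).next_face _).trans
    ((dartOpp_outDart_previous hτ π (Sum.inr (t, b))).trans (next_outDart hτ π ρ t b).symm))

/-- The sweep of the map with given sweep data. -/
def sweep : Sweep (toMap hτ π ρ) τ π where
  eps_eq := rfl
  pos t s := outDart (current τ t s)
  pos_zero s := rfl
  pos_succ_of_ne t s h1 h2 := by rw [current_succ_of_ne τ t h1 h2]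
  pos_succ_fst t :=
    (congrArg outDart (current_succ_strandOf hτ t true)).trans
      (face_outDart_previous hτ π ρ t true).symm
  pos_succ_snd t :=
    (congrArg outDart (current_succ_strandOf hτ t false)).trans
      (face_outDart_previous hτ π ρ t false).symm
  vertex_fst t := by
    have h := current_succ_strandOf hτ t true
    change current τ (t + 1) (τ t).1 = _ at h
    rw [h]
    rfl
  next_next_fst t := by
    have h1 := current_succ_strandOf hτ t true
    have h2 := current_succ_strandOf hτ t false
    change current τ (t + 1) (τ t).1 = _ at h1
    change current τ (t + 1) (τ t).2 = _ at h2
    rw [h1, h2, next_outDart]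
    rfl
  opp_last s := dartOpp_outDart_previous hτ π (Sum.inl s)

end StrandModel

/-! ## The sum over the maps -/

section MapSums

theorem prod_outLabel_mul_prod_inLabel {I : Type} [Fintype I] {ε : I → ℤˣ} (f : I → ℂ) :
    (∏ s : OutLabel ε, f s) * ∏ s : InLabel ε, f s = ∏ k, f k := by
  rw [← Fintype.prod_subtype_mul_prod_subtype (fun k => ε k = 1) f]
  congr 1
  exact Fintype.prod_equiv (Equiv.subtypeEquivRight fun k =>
    ⟨fun h h' => absurd (h.symm.trans h') (by decide),
      fun h => (Int.units_eq_one_or (ε k)).resolve_left h⟩) _ _ fun _ => rfl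

variable {I : Type} [Fintype I] [LinearOrder I] {r : ℕ} {ε : I → ℤˣ}

/-- The class of the map with given sweep data. -/
def mapOfData (ρ : Equiv.Perm I) (d : MonoSeq (OutLabel ε) r × (OutLabel ε ≃ InLabel ε)) :
    MapClass I r ε ρ :=
  Quotient.mk (NondecreasingMap.setoid I r ε ρ)
    ⟨StrandModel.toMap (fun t => (d.1.lt t).ne) d.2 ρ, by
      intro k l hkl
      have W := StrandModel.sweep (fun t => (d.1.lt t).ne) d.2 ρ
      rw [W.val_eq d.1.lt, W.val_eq d.1.lt]
      exact d.1.mono hkl,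
      StrandModel.toMap_eps _ _ _, StrandModel.toMap_rho _ _ _⟩

/-- Injective because sweep data are transported by isomorphisms and unique; surjective because
every map has a sweep and is isomorphic to the model with the same data. -/
theorem mapOfData_bijective (ρ : Equiv.Perm I) :
    Function.Bijective (mapOfData (r := r) (ε := ε) ρ) := by
  constructor
  · intro d d' h
    obtain ⟨e⟩ : Nonempty (UnitaryMap.Iso
        (StrandModel.toMap (fun t => (d.1.lt t).ne) d.2 ρ)
        (StrandModel.toMap (fun t => (d'.1.lt t).ne) d'.2 ρ)) :=
      Quotient.exact (s := NondecreasingMap.setoid I r ε ρ) h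
    have W := StrandModel.sweep (fun t => (d.1.lt t).ne) d.2 ρ
    have V := StrandModel.sweep (fun t => (d'.1.lt t).ne) d'.2 ρ
    obtain ⟨h1, h2⟩ := (W.ofIso e).data_unique V d.1.lt d'.1.lt
    exact Prod.ext (MonoSeq.ext h1) h2
  · intro c
    obtain ⟨⟨C, hC, hε, hρ⟩, rfl⟩ := Quotient.exists_rep c
    obtain ⟨τ, π, hτ, ⟨W⟩⟩ := C.exists_sweep hε
    have hmono : Monotone fun t => (τ t).2 := fun k l hkl => by
      have := hC hkl
      rw [W.val_eq hτ, W.val_eq hτ] at this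
      exact this
    refine ⟨(⟨τ, hτ, hmono⟩, π), ?_⟩
    have V := StrandModel.sweep (fun t => (hτ t).ne) π ρ
    exact Quotient.sound (s := NondecreasingMap.setoid I r ε ρ)
      ⟨V.iso W ((StrandModel.toMap_rho _ _ _).trans hρ.symm)⟩

theorem finite_mapClass (ρ : Equiv.Perm I) : Finite (MapClass I r ε ρ) :=
  Finite.of_surjective _ (mapOfData_bijective ρ).2

theorem phi_mapOfData_out (ρ : Equiv.Perm I)
    (d : MonoSeq (OutLabel ε) r × (OutLabel ε ≃ InLabel ε)) (s : OutLabel ε) :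
    (mapOfData ρ d).phi s = ρ⁻¹ (d.2 s) := by
  have := (StrandModel.sweep (fun t => (d.1.lt t).ne) d.2 ρ).phi_out s
  rw [StrandModel.toMap_rho] at this
  exact this

theorem phi_mapOfData_in (ρ : Equiv.Perm I)
    (d : MonoSeq (OutLabel ε) r × (OutLabel ε ≃ InLabel ε)) (s : OutLabel ε) :
    (mapOfData ρ d).phi (d.2 s) = ρ⁻¹ (d.1.perm s : OutLabel ε) := by
  have := (StrandModel.sweep (fun t => (d.1.lt t).ne) d.2 ρ).phi_in s
  rw [StrandModel.toMap_rho] at this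
  exact this

variable {N : ℕ}

/-- Isolates the dependence on `σ` in an indicator, so that summing over maps becomes counting. -/
theorem permTrace_eq_sum_sum (σ : Equiv.Perm I) (M : I → Matrix (Fin N) (Fin N) ℂ) :
    permTrace σ M = ∑ x : I → Fin N, ∑ y : I → Fin N,
      (∏ k, M k (x k) (y k)) * if ∀ k, y k = x (σ k) then 1 else 0 := by
  rw [permTrace_eq_sum]
  have := sum_prod_mul_apply M (fun _ => (1 : Matrix (Fin N) (Fin N) ℂ)) σ
  simp only [Matrix.mul_one] at this
  rw [this]
  refine Finset.sum_congr rfl fun x _ => Finset.sum_congr rfl fun y _ => ?_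
  congr 1
  simp only [Matrix.one_apply]
  rw [Fintype.prod_ite_zero]
  simp

/-- Every label is some `s` or some `π s`, and the formulas for `φ` turn the indicator into `y s = x
(ρ⁻¹ (π s))` and `y (π s) = x (ρ⁻¹ (τ s))`. Replacing `π` by `π ∘ τ⁻¹` gives the conditions of
`matchCount`. -/
theorem sum_phi_indicator (ρ : Equiv.Perm I) (x y : I → Fin N) :
    ∑ d : MonoSeq (OutLabel ε) r × (OutLabel ε ≃ InLabel ε),
        (if ∀ k, y k = x ((mapOfData ρ d).phi k) then (1 : ℂ) else 0) =
      monotoneCount r (fun s : OutLabel ε => y s) (fun s : OutLabel ε => x (ρ⁻¹ s))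
        (fun s : InLabel ε => x (ρ⁻¹ s)) (fun s : InLabel ε => y s) := by
  rw [Fintype.sum_prod_type]
  unfold monotoneCount matchCount
  refine Finset.sum_congr rfl fun τ _ => ?_
  refine Eq.trans (Finset.sum_congr rfl fun π _ => ?_)
    ((Equiv.equivCongr τ.perm (Equiv.refl (InLabel ε))).sum_comp _)
  refine if_congr ?_ rfl rfl
  rw [τ.perm.surjective.forall]
  have hsplit : (∀ k, y k = x ((mapOfData ρ (τ, π)).phi k)) ↔
      ∀ s : OutLabel ε, y s = x ((mapOfData ρ (τ, π)).phi s) ∧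
        y (π s) = x ((mapOfData ρ (τ, π)).phi (π s)) := by
    refine ⟨fun h s => ⟨h s, h (π s)⟩, fun h k => ?_⟩
    rcases Int.units_eq_one_or (ε k) with hk | hk
    · exact (h ⟨k, hk⟩).1
    · have := (h (π.symm ⟨k, hk⟩)).2
      rwa [Equiv.apply_symm_apply] at this
  rw [hsplit]
  refine forall_congr' fun s => ?_
  rw [phi_mapOfData_out ρ (τ, π) s, phi_mapOfData_in ρ (τ, π) s]
  have h1 : τ.perm⁻¹ (τ.perm s) = s := τ.perm.symm_apply_apply s
  have h2 : (Equiv.equivCongr τ.perm (Equiv.refl (InLabel ε)) π) (τ.perm s) = π s := by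
    simp [Equiv.equivCongr]
  rw [h1, h2]
  exact and_congr Iff.rfl eq_comm

theorem finsum_permTrace_phi (ρ : Equiv.Perm I) (M : I → Matrix (Fin N) (Fin N) ℂ) :
    ∑ᶠ C : MapClass I r ε ρ, permTrace C.phi M = ∑ x : I → Fin N, ∑ y : I → Fin N,
      (∏ k, M k (x k) (y k)) * monotoneCount r (fun s : OutLabel ε => y s)
        (fun s : OutLabel ε => x (ρ⁻¹ s)) (fun s : InLabel ε => x (ρ⁻¹ s))
        (fun s : InLabel ε => y s) := by
  rw [← finsum_eq_of_bijective (f := fun d => permTrace (mapOfData ρ d).phi M) _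
    (mapOfData_bijective (r := r) (ε := ε) ρ) fun _ => rfl, finsum_eq_sum_of_fintype]
  simp_rw [permTrace_eq_sum_sum]
  rw [Finset.sum_comm]
  refine Finset.sum_congr rfl fun x _ => ?_
  rw [Finset.sum_comm]
  refine Finset.sum_congr rfl fun y _ => ?_
  rw [← Finset.mul_sum, sum_phi_indicator]

end MapSums

/-! ## The Haar moments -/

section HaarMoments

variable {N p l : ℕ}

theorem haarMoment_eq_sum (A : Fin p → Matrix (Fin N) (Fin N) ℂ) (P : Fin l → Monomial p) :
    haarMoment A (fun i => (P i).toPoly) =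
      ∑ x : Fin (totalDeg P) → Fin N, ∑ y : Fin (totalDeg P) → Fin N,
        (∏ k, coeffs A P k (x k) (y k)) * entryMoment (fun s : OutLabel (signs P) => y s)
          (fun s : OutLabel (signs P) => x (gammaPerm P s))
          (fun s : InLabel (signs P) => x (gammaPerm P s))
          (fun s : InLabel (signs P) => y s) := by
  have hprod : ∀ (U : Matrix (Fin N) (Fin N) ℂ) (x y : Fin (totalDeg P) → Fin N),
      ∏ k, signPow U (signs P k) (y k) (x (gammaPerm P k)) =
        entryProd (fun s : OutLabel (signs P) => y s)
          (fun s : OutLabel (signs P) => x (gammaPerm P s))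
          (fun s : InLabel (signs P) => x (gammaPerm P s))
          (fun s : InLabel (signs P) => y s) U := by
    intro U x y
    rw [← prod_outLabel_mul_prod_inLabel (ε := signs P), entryProd]
    congr 1
    · refine Finset.prod_congr rfl fun s _ => ?_
      rw [s.2, signPow, if_pos rfl]
    · refine Finset.prod_congr rfl fun s _ => ?_
      rw [s.2, signPow, if_neg (by decide)]
  unfold haarMoment
  simp_rw [prod_trace_evalPoly, sum_prod_mul_apply, hprod]
  have hint : ∀ x y : Fin (totalDeg P) → Fin N, Integrable
      (fun U : Matrix.unitaryGroup (Fin N) ℂ => (∏ k, coeffs A P k (x k) (y k)) *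
        entryProd (fun s : OutLabel (signs P) => y s)
          (fun s : OutLabel (signs P) => x (gammaPerm P s))
          (fun s : InLabel (signs P) => x (gammaPerm P s))
          (fun s : InLabel (signs P) => y s) (U : Matrix (Fin N) (Fin N) ℂ)) (haarUnitary N) :=
    fun x y => (integrable_haarUnitary (continuous_entryProd _ _ _ _)).const_mul _
  rw [integral_finsetSum _ fun x _ => integrable_finsetSum _ fun y _ => hint x y]
  refine Finset.sum_congr rfl fun x _ => ?_
  rw [integral_finsetSum _ fun y _ => hint x y]
  refine Finset.sum_congr rfl fun y _ => ?_
  rw [integral_const_mul]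
  rfl

/-- The index functions are those of `haarMoment_eq_sum`, because `ρ = γ⁻¹`; the two sums can be
compared term by term. -/
theorem mapSum_eq_sum (A : Fin p → Matrix (Fin N) (Fin N) ℂ) (P : Fin l → Monomial p) (r : ℕ) :
    mapSum A P r =
      ∑ x : Fin (totalDeg P) → Fin N, ∑ y : Fin (totalDeg P) → Fin N,
        (∏ k, coeffs A P k (x k) (y k)) * monotoneCount r (fun s : OutLabel (signs P) => y s)
          (fun s : OutLabel (signs P) => x (gammaPerm P s))
          (fun s : InLabel (signs P) => x (gammaPerm P s))
          (fun s : InLabel (signs P) => y s) := by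
  unfold mapSum
  rw [finsum_permTrace_phi]
  simp only [inv_inv]

theorem card_outLabel_add_card_inLabel (P : Fin l → Monomial p) :
    Fintype.card (OutLabel (signs P)) + Fintype.card (InLabel (signs P)) = totalDeg P := by
  have h : Fintype.card (InLabel (signs P)) = Fintype.card {k // ¬ signs P k = 1} :=
    Fintype.card_congr (Equiv.subtypeEquivRight fun k =>
      ⟨fun h h' => absurd (h.symm.trans h') (by decide),
        fun h => (Int.units_eq_one_or _).resolve_left h⟩)
  rw [h, ← Fintype.card_sum]
  exact (Fintype.card_congr (Equiv.sumCompl _)).trans (Fintype.card_fin _)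

end HaarMoments

end UnitaryMaps

end

/-! ### Conclusion: comparison of the two sums over indices -/

theorem corollary3p8 (N : ℕ) (hN : 1 ≤ N) (p : ℕ) (A : Fin p → Matrix (Fin N) (Fin N) ℂ)
    (l : ℕ) (hl : 1 ≤ l) (P : Fin l → UnitaryMaps.Monomial p)
    (m : ℝ) (hm : m = (UnitaryMaps.totalDeg P : ℝ) / 2) (hmN : m ≤ N) :
    (∀ r : ℕ, Finite (UnitaryMaps.MapsOf P r)) ∧
    Summable (fun r : ℕ =>
      ‖(((-1 : ℝ) ^ r / (N : ℝ) ^ ((r : ℝ) + m) : ℝ) : ℂ) * UnitaryMaps.mapSum A P r‖) ∧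
    HasSum (fun r : ℕ =>
        (((-1 : ℝ) ^ r / (N : ℝ) ^ ((r : ℝ) + m) : ℝ) : ℂ) * UnitaryMaps.mapSum A P r)
      (UnitaryMaps.haarMoment A fun i => (P i).toPoly) := by
  open UnitaryMaps in
  refine ⟨fun r => finite_mapClass _, ?_⟩
  have hcard := card_outLabel_add_card_inLabel P
  by_cases hbal : Fintype.card (OutLabel (signs P)) = Fintype.card (InLabel (signs P))
  -- With as many `u` as `u⁻¹`, the half-degree is the number of strands, and the real power of `N`
  -- is an integral one.
  · have hmn : m = (Fintype.card (OutLabel (signs P)) : ℝ) := by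
      have hdeg : (totalDeg P : ℝ) = Fintype.card (OutLabel (signs P)) +
          Fintype.card (InLabel (signs P)) := by exact_mod_cast hcard.symm
      rw [hm, hdeg, ← hbal]
      ring
    have hnN : Fintype.card (OutLabel (signs P)) ≤ N := by
      rw [hmn] at hmN
      exact_mod_cast hmN
    have hpref : ∀ r : ℕ, (((-1 : ℝ) ^ r / (N : ℝ) ^ ((r : ℝ) + m) : ℝ) : ℂ) =
        (-1) ^ r / (N : ℂ) ^ (r + Fintype.card (OutLabel (signs P))) := by
      intro r
      rw [hmn, ← Nat.cast_add, Real.rpow_natCast]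
      push_cast
      ring
    have hterm : ∀ r : ℕ, (((-1 : ℝ) ^ r / (N : ℝ) ^ ((r : ℝ) + m) : ℝ) : ℂ) * mapSum A P r =
        ∑ x : Fin (totalDeg P) → Fin N, ∑ y : Fin (totalDeg P) → Fin N,
        (∏ k, coeffs A P k (x k) (y k)) * expansionTerm r (fun s : OutLabel (signs P) => y s)
          (fun s : OutLabel (signs P) => x (gammaPerm P s))
          (fun s : InLabel (signs P) => x (gammaPerm P s))
          (fun s : InLabel (signs P) => y s) := by
      intro r
      rw [hpref, mapSum_eq_sum, Finset.mul_sum]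
      refine Finset.sum_congr rfl fun x _ => ?_
      rw [Finset.mul_sum]
      refine Finset.sum_congr rfl fun y _ => ?_
      rw [expansionTerm]
      ring
    simp_rw [hterm]
    rw [haarMoment_eq_sum]
    constructor
    · refine Summable.of_nonneg_of_le (fun r => norm_nonneg _)
        (fun r => (norm_sum_le _ _).trans (Finset.sum_le_sum fun x _ => norm_sum_le _ _)) ?_
      refine summable_sum fun x _ => summable_sum fun y _ => ?_
      simp_rw [norm_mul]
      exact (hasSum_expansionTerm hN hbal hnN _ _ _ _).1.mul_left _
    · exact hasSum_sum fun x _ => hasSum_sum fun y _ =>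
        (hasSum_expansionTerm hN hbal hnN _ _ _ _).2.mul_left _
  -- Odd total degree falls under this case, so half-integral powers of `N` only multiply zero.
  · have hmap : ∀ r, mapSum A P r = 0 := by
      intro r
      have : IsEmpty (OutLabel (signs P) ≃ InLabel (signs P)) :=
        ⟨fun e => hbal (Fintype.card_congr e)⟩
      rw [mapSum_eq_sum]
      simp [monotoneCount, matchCount]
    have hmoment : haarMoment A (fun i => (P i).toPoly) = 0 := by
      rw [haarMoment_eq_sum]
      simp [entryMoment_eq_zero_of_card_ne _ _ _ _ hbal]
    simp_rw [hmap, hmoment, mul_zero, norm_zero]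
    exact ⟨summable_zero, hasSum_zero⟩
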